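/- All locally convex spaces are Hausdorff and over $\mathbb C$. For a locally convex space $X$, let $X^\star$ be the space of continuous linear functionals on $X$ with the topology of uniform convergence on totally bounded sets; $X$ is *stereotype* if the evaluation map $X\to X^{\star\star}$ is an isomorphism of locally convex spaces. $X$ is *pseudocomplete* if every totally bounded Cauchy net in $X$ converges. A set $D\subseteq X$ is *capacious* if for every totally bounded $S\subseteq X$ there is a finite $F\subseteq X$ with $S\subseteq D+F$, and $X$ is *pseudosaturated* if every closed convex balanced capacious set in $X$ is a neighbourhood of zero. The *pseudosaturation* $X^\vartriangle$ is the vector space $X$ with the coarsest pseudosaturated locally convex topology finer than the original one; $\vartriangle_X:X^\vartriangle\to X$ is the identity map, and for a continuous linear map $\varphi:X\to Y$ the same map is continuous as $\varphi^\vartriangle:X^\vartriangle\to Y^\vartriangle$. For locally convex spaces $X,Y$, let $Y:X$ be the space of continuous linear maps $X\to Y$ with the topology of uniform convergence on totally bounded sets. The *primary tensor product* $X\cdot Y$ is the space of continuous linear maps $X^\star\to Y$ with the topology of uniform convergence on the polars $U^\circ\subseteq X^\star$ of the neighbourhoods of zero $U\subseteq X$; continuous linear maps $\alpha:X'\to X$,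 $\beta:Y'\to Y$ induce a continuous linear map $\alpha\cdot\beta:X'\cdot Y'\to X\cdot Y$, $\psi\mapsto\beta\circ\psi\circ\alpha^\star$. For stereotype $X,Y$ the *injective stereotype tensor product* is $X\odot Y=Y\oslash X^\star=(Y:X^\star)^\vartriangle$. **Theorem.** Let $X$ and $Y$ be pseudocomplete locally convex spaces. Then $X^\vartriangle$ and $Y^\vartriangle$ are stereotype, and the pseudosaturation $$(\vartriangle_X\cdot\vartriangle_Y)^\vartriangle:(X^\vartriangle\cdot Y^\vartriangle)^\vartriangle\to(X\cdot Y)^\vartriangle$$ of the natural map $\vartriangle_X\cdot\vartriangle_Y:X^\vartriangle\cdot Y^\vartriangle\to X\cdot Y$ is an isomorphism of locally convex spaces. Moreover, the map that is the identity on operators $(X^\vartriangle)^\star\to Y^\vartriangle$ is an isomorphism of locally convex spaces $X^\vartriangle\odot Y^\vartriangle\to(X^\vartriangle\cdot Y^\vartriangle)^\vartriangle$. Hence $$X^\vartriangle\odot Y^\vartriangle\cong(X^\vartriangle\cdot Y^\vartriangle)^\vartriangle\cong(X\cdot Y)^\vartriangle .$$ -/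

import Mathlib

open Set Filter Topology
open scoped Pointwise

namespace Stereotype

section Basic

variable {X : Type*} [AddCommGroup X] [TopologicalSpace X]

/-- Totally bounded sets of a topological vector space: every neighbourhood `U` of zero has finitely
many translates covering the set. -/
def IsTotBounded (S : Set X) : Prop :=
  ∀ U ∈ 𝓝 (0 : X), ∃ F : Set X, F.Finite ∧ S ⊆ F + U

/-- Capacious sets: every totally bounded set is covered by finitely many translates. -/
def IsCapacious (D : Set X) : Prop :=
  ∀ S : Set X, IsTotBounded S → ∃ F : Set X, F.Finite ∧ S ⊆ D + F

variable (X) in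
/-- Every totally bounded Cauchy filter (equivalently, net) converges. -/
def IsPseudocomplete : Prop :=
  ∀ S : Set X, IsTotBounded S → ∀ l : Filter X, l.NeBot → S ∈ l →
    (∀ U ∈ 𝓝 (0 : X), ∃ A ∈ l, ∀ x ∈ A, ∀ y ∈ A, x - y ∈ U) → ∃ x, l ≤ 𝓝 x

variable (X) in
/-- Every closed convex balanced capacious set is a neighbourhood of zero. -/
def IsPseudosaturated [Module ℂ X] : Prop :=
  ∀ D : Set X, IsClosed D → Convex ℝ D → Balanced ℂ D → IsCapacious D → D ∈ 𝓝 (0 : X)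

/-- The definition agrees with Mathlib's notion for uniform spaces. -/
theorem isTotBounded_iff_totallyBounded {G : Type*} [AddCommGroup G] [UniformSpace G]
    [IsUniformAddGroup G] (S : Set G) : IsTotBounded S ↔ TotallyBounded S := by
  rw [totallyBounded_iff_subset_finite_iUnion_nhds_zero]
  refine forall₂_congr fun U _ => exists_congr fun F => and_congr_right fun _ => ?_
  rw [Set.iUnion_vadd_set, vadd_eq_add]

theorem IsTotBounded.mono {S T : Set X} (hT : IsTotBounded T) (h : S ⊆ T) : IsTotBounded S :=
  fun U hU => let ⟨F, hF, hS⟩ := hT U hU; ⟨F, hF, h.trans hS⟩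

theorem IsTotBounded.union {S T : Set X} (hS : IsTotBounded S) (hT : IsTotBounded T) :
    IsTotBounded (S ∪ T) := fun U hU => by
  obtain ⟨F, hF, hS⟩ := hS U hU
  obtain ⟨G, hG, hT⟩ := hT U hU
  refine ⟨F ∪ G, hF.union hG, ?_⟩
  rw [Set.union_add]
  exact Set.union_subset_union hS hT

theorem IsTotBounded.image {Y : Type*} [AddCommGroup Y] [TopologicalSpace Y] {S : Set X}
    (hS : IsTotBounded S) (f : X →+ Y) (hf : Continuous f) : IsTotBounded (f '' S) := by
  intro U hU
  have hf0 : f ⁻¹' U ∈ 𝓝 (0 : X) := hf.continuousAt.preimage_mem_nhds (by rwa [map_zero])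
  obtain ⟨F, hF, hS⟩ := hS _ hf0
  refine ⟨f '' F, hF.image f, ?_⟩
  refine (Set.image_mono hS).trans ?_
  rw [Set.image_add]
  exact Set.add_subset_add_left (Set.image_preimage_subset f U)

theorem IsTotBounded.isVonNBounded [IsTopologicalAddGroup X] [Module ℂ X] [ContinuousSMul ℂ X]
    {S : Set X} (hS : IsTotBounded S) : Bornology.IsVonNBounded ℂ S := by
  let _ := IsTopologicalAddGroup.rightUniformSpace X
  have _ : IsUniformAddGroup X := isUniformAddGroup_of_addCommGroup
  exact ((isTotBounded_iff_totallyBounded S).1 hS).isVonNBounded ℂ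

theorem isTotBounded_of_isCompact [IsTopologicalAddGroup X] {S : Set X} (hS : IsCompact S) :
    IsTotBounded S := by
  let _ := IsTopologicalAddGroup.rightUniformSpace X
  have _ : IsUniformAddGroup X := isUniformAddGroup_of_addCommGroup
  exact (isTotBounded_iff_totallyBounded S).2 hS.totallyBounded

theorem IsCapacious.zero_mem [Module ℂ X] {D : Set X} (hD : IsCapacious D) (hb : Balanced ℂ D) :
    (0 : X) ∈ D := by
  obtain ⟨F, -, hF⟩ := hD {0} fun U hU =>
    ⟨{0}, Set.finite_singleton _, by simpa using mem_of_mem_nhds hU⟩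
  obtain ⟨d, hd, -⟩ := hF rfl
  exact hb.zero_mem ⟨d, hd⟩

theorem IsCapacious.absorbent [IsTopologicalAddGroup X] [Module ℂ X] [ContinuousSMul ℂ X]
    {D : Set X} (hD : IsCapacious D) (hc : Convex ℝ D) (hb : Balanced ℂ D) : Absorbent ℝ D := by
  have key : ∀ x : X, ∃ r : ℝ, 0 < r ∧ r • x ∈ D := by
    intro x
    have hK : IsCompact ((fun c : ℝ => (c : ℂ) • x) '' Icc 0 1) :=
      isCompact_Icc.image (by fun_prop)
    obtain ⟨F, hF, hS⟩ := hD _ (isTotBounded_of_isCompact hK)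
    have h1 : ∀ n : ℕ, ∃ f : F, ((1 / ((n : ℝ) + 1) : ℝ) : ℂ) • x - f.1 ∈ D := by
      intro n
      have : ((1 / ((n : ℝ) + 1) : ℝ) : ℂ) • x ∈ D + F := by
        refine hS ⟨_, ⟨by positivity, ?_⟩, rfl⟩
        rw [div_le_one (by positivity)]
        have : (0 : ℝ) ≤ n := n.cast_nonneg
        linarith
      obtain ⟨d, hd, f, hf, h⟩ := this
      refine ⟨⟨f, hf⟩, ?_⟩
      rw [← h]
      simpa using hd
    choose f hf using h1
    have := hF.to_subtype
    obtain ⟨m, n, hmn, hfmn⟩ := Finite.exists_ne_map_eq_of_infinite f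
    wlog hlt : m < n generalizing m n
    · exact this n m hmn.symm hfmn.symm (lt_of_le_of_ne (not_lt.1 hlt) hmn.symm)
    have hm := hf m
    have hn := hf n
    rw [← hfmn] at hn
    have hn' := hb.neg_mem_iff.2 hn
    have hmid := hc hm hn' (by norm_num : (0 : ℝ) ≤ 1 / 2) (by norm_num : (0 : ℝ) ≤ 1 / 2)
      (by norm_num)
    refine ⟨1 / 2 * (1 / ((m : ℝ) + 1) - 1 / ((n : ℝ) + 1)), ?_, ?_⟩
    · have : (1 : ℝ) / ((n : ℝ) + 1) < 1 / ((m : ℝ) + 1) :=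
        one_div_lt_one_div_of_lt (by positivity) (by exact_mod_cast Nat.succ_lt_succ hlt)
      linarith
    · convert hmid using 1
      rw [Complex.coe_smul, Complex.coe_smul]
      module
  intro x
  obtain ⟨r, hr, hrx⟩ := key x
  have h0 := hD.zero_mem hb
  rw [absorbs_iff_eventually_nhds_zero h0]
  filter_upwards [Metric.ball_mem_nhds (0 : ℝ) hr] with c hc
  rw [mapsTo_singleton]
  have hb' := hb.smul_mem (a := ((c / r : ℝ) : ℂ)) (by
    rw [Complex.norm_real, norm_div, Real.norm_of_nonneg hr.le, div_le_one hr]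
    exact (mem_ball_zero_iff.1 hc).le) hrx
  rwa [Complex.coe_smul, smul_smul, div_mul_cancel₀ _ hr.ne'] at hb'

/-- Preimages of capacious sets are capacious, up to a factor. -/
theorem IsCapacious.preimage {Y : Type*} [AddCommGroup Y] [TopologicalSpace Y] [Module ℂ X]
    [Module ℂ Y] {D : Set Y} (hD : IsCapacious D) (hc : Convex ℝ D) (hb : Balanced ℂ D)
    (f : X →L[ℂ] Y) : IsCapacious (f ⁻¹' ((2 : ℂ) • D)) := by
  intro S hS
  obtain ⟨F, hF, hSF⟩ := hD _ (hS.image f.toLinearMap.toAddMonoidHom f.continuous)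
  have hch : ∀ y : Y, ∃ x : X, (∃ x' ∈ S, f x' - y ∈ D) → x ∈ S ∧ f x - y ∈ D := by
    intro y
    by_cases h : ∃ x' ∈ S, f x' - y ∈ D
    · obtain ⟨x, hx⟩ := h
      exact ⟨x, fun _ => hx⟩
    · exact ⟨0, fun h' => absurd h' h⟩
  choose g hg using hch
  refine ⟨g '' F, hF.image g, fun x hx => ?_⟩
  obtain ⟨d, hd, y, hy, hxy⟩ := hSF ⟨x, hx, rfl⟩
  have hxd : f x - y = d := by
    rw [sub_eq_iff_eq_add]
    exact hxy.symm
  have hgy := (hg y ⟨x, hx, hxd ▸ hd⟩).2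
  refine ⟨x - g y, ?_, g y, ⟨y, hy, rfl⟩, sub_add_cancel _ _⟩
  have hmid := hc hd (hb.neg_mem_iff.2 hgy) (by norm_num : (0 : ℝ) ≤ 1 / 2)
    (by norm_num : (0 : ℝ) ≤ 1 / 2) (by norm_num)
  refine ⟨_, hmid, ?_⟩
  simp only [← hxd, map_sub, ← Complex.coe_smul]
  push_cast
  module

end Basic

noncomputable section Pseudosaturation

section Topologies

variable {E F ι : Type*} [AddCommGroup E] [Module ℂ E] [AddCommGroup F] [Module ℂ F]

theorem isTopologicalAddGroup_of_withSeminorms {s : TopologicalSpace E} {q : SeminormFamily ℂ E ι}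
    (hq : WithSeminorms (topology := s) q) : @IsTopologicalAddGroup E s _ :=
  hq.topologicalAddGroup

theorem continuousSMul_of_withSeminorms {s : TopologicalSpace E} {q : SeminormFamily ℂ E ι}
    (hq : WithSeminorms (topology := s) q) : @ContinuousSMul ℂ E _ _ s :=
  hq.continuousSMul

theorem continuous_seminorm_of_withSeminorms {s : TopologicalSpace E} {q : SeminormFamily ℂ E ι}
    (hq : WithSeminorms (topology := s) q) (i : ι) : @Continuous E ℝ s _ (q i) :=
  hq.continuous_seminorm i

theorem continuous_of_withSeminorms {s : TopologicalSpace E} {s' : TopologicalSpace F}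
    (hs : @IsTopologicalAddGroup E s _) {q : SeminormFamily ℂ F ι}
    (hq : WithSeminorms (topology := s') q) (f : E →ₗ[ℂ] F)
    (hf : ∀ i, @Continuous E ℝ s _ ((q i).comp f)) : @Continuous E F s s' f :=
  hq.continuous_of_continuous_comp f hf

end Topologies


variable {X : Type*} [AddCommGroup X] [Module ℂ X]

/-- `s` is a pseudosaturated locally convex topology on `X`, finer than the topology `t`. -/
structure IsPseudosaturatedRefinement (t s : TopologicalSpace X) : Prop where
  le : s ≤ t
  locallyConvex : @PolynormableSpace ℂ X _ _ _ s
  pseudosaturated : @IsPseudosaturated X _ s _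

/-- The seminorms that are continuous for every pseudosaturated locally convex topology finer than
`t`. -/
def pseudosatSeminorms (t : TopologicalSpace X) : SeminormFamily ℂ X
    {p : Seminorm ℂ X //
      ∀ s : TopologicalSpace X, IsPseudosaturatedRefinement t s → @Continuous X ℝ s _ p} :=
  fun p => p.1

/-- The topology of the pseudosaturation: the coarsest pseudosaturated locally convex topology
finer than the topology `t` of a locally convex space. It is generated by the seminorms above;
that it is itself such a topology, and the coarsest one, is proved below. -/
@[reducible]
def pseudosatTopology (t : TopologicalSpace X) : TopologicalSpace X :=
  (pseudosatSeminorms t).moduleFilterBasis.topology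

theorem withSeminorms_pseudosat (t : TopologicalSpace X) :
    WithSeminorms (topology := pseudosatTopology t) (pseudosatSeminorms t) :=
  @WithSeminorms.mk _ _ _ _ _ _ _ (_) rfl

theorem IsPseudosaturatedRefinement.isTopologicalAddGroup {t s : TopologicalSpace X}
    (hs : IsPseudosaturatedRefinement t s) : @IsTopologicalAddGroup X s _ :=
  isTopologicalAddGroup_of_withSeminorms hs.locallyConvex.withSeminorms'

theorem IsPseudosaturatedRefinement.le_pseudosatTopology {t s : TopologicalSpace X}
    (hs : IsPseudosaturatedRefinement t s) : s ≤ pseudosatTopology t :=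
  continuous_id_iff_le.1 <| continuous_of_withSeminorms hs.isTopologicalAddGroup
    (withSeminorms_pseudosat t) LinearMap.id fun p => p.2 s hs

theorem pseudosatTopology_le {t : TopologicalSpace X} (ht : PolynormableSpace ℂ X) :
    pseudosatTopology t ≤ t :=
  continuous_id_iff_le.1 <| continuous_of_withSeminorms
    (isTopologicalAddGroup_of_withSeminorms (withSeminorms_pseudosat t))
    (PolynormableSpace.withSeminorms ℂ X) LinearMap.id fun p =>
      continuous_seminorm_of_withSeminorms (withSeminorms_pseudosat t)
        ⟨p.1, fun s hs => @Continuous.comp _ _ _ s t _ id _ p.2 (continuous_id_iff_le.2 hs.le)⟩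

theorem mem_nhds_of_continuous_gauge [TopologicalSpace X] {D : Set X} (hc : Convex ℝ D) (hb : Balanced ℂ D)
    (ha : Absorbent ℝ D) (h : Continuous (gaugeSeminorm hb hc ha : Seminorm ℂ X)) :
    D ∈ 𝓝 (0 : X) := by
  have : {x | (gaugeSeminorm hb hc ha : Seminorm ℂ X) x < 1} ∈ 𝓝 (0 : X) :=
    (isOpen_lt h continuous_const).mem_nhds (by simp only [mem_ofPred_eq, map_zero, zero_lt_one])
  exact mem_of_superset this fun x hx => setOfPred_gauge_lt_one_subset_self hc ha.zero_mem ha hx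

theorem continuous_gauge_comp {A X : Type*} [AddCommGroup A] [Module ℂ A] [TopologicalSpace A]
    [IsTopologicalAddGroup A] [ContinuousSMul ℂ A] [AddCommGroup X] [Module ℂ X]
    {D : Set X} (hc : Convex ℝ D) (hb : Balanced ℂ D) (ha : Absorbent ℝ D) (f : A →ₗ[ℂ] X)
    (h : f ⁻¹' ((2 : ℂ) • D) ∈ 𝓝 (0 : A)) :
    Continuous ((gaugeSeminorm hb hc ha).comp f : Seminorm ℂ A) := by
  refine Seminorm.continuous' (r := 2) (mem_of_superset h fun x hx => ?_)
  rw [Seminorm.mem_closedBall_zero, Seminorm.comp_apply]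
  refine gauge_le_of_mem (by norm_num) ?_
  have h2 : ((2 : ℂ) • D) = (2 : ℝ) • D := by
    ext y
    simp only [Set.mem_smul_set, ← Complex.coe_smul]
    norm_num
  rw [← h2]
  exact hx

/-- If `D` is closed, convex, balanced and capacious in the target of a continuous linear map from
a pseudosaturated space, then the gauge of `D` is continuous along the map. -/
theorem IsPseudosaturated.continuous_gauge_comp {A X : Type*} [AddCommGroup A] [Module ℂ A]
    [TopologicalSpace A] [IsTopologicalAddGroup A] [ContinuousSMul ℂ A] [AddCommGroup X]
    [Module ℂ X] [TopologicalSpace X] [ContinuousConstSMul ℂ X]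
    (hA : IsPseudosaturated A) {D : Set X} (hD : IsCapacious D) (hcl : IsClosed D)
    (hc : Convex ℝ D) (hb : Balanced ℂ D) (ha : Absorbent ℝ D) (f : A →L[ℂ] X) :
    Continuous ((gaugeSeminorm hb hc ha).comp f.toLinearMap : Seminorm ℂ A) := by
  refine Stereotype.continuous_gauge_comp hc hb ha f.toLinearMap
    (hA _ ((hcl.smul_of_ne_zero two_ne_zero).preimage f.continuous) ?_ ?_ (hD.preimage hc hb f))
  · have : Convex ℝ ((2 : ℂ) • D) := hc.smul _
    exact this.is_linear_preimage ⟨map_add f, fun c x => by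
      rw [← Complex.coe_smul, map_smul, Complex.coe_smul]⟩
  · intro c hc' y
    rintro ⟨x, ⟨d, hd, hx⟩, rfl⟩
    exact ⟨c • d, hb.smul_mem hc' hd, by simp [← show (2 : ℂ) • d = f x from hx, smul_comm c]⟩

theorem isPseudosaturated_of_withSeminorms {X ι : Type*} [AddCommGroup X] [Module ℂ X]
    {s : TopologicalSpace X} {q : SeminormFamily ℂ X ι} (hq : WithSeminorms (topology := s) q)
    (h : ∀ D : Set X, IsClosed[s] D → IsCapacious D → ∀ (hc : Convex ℝ D) (hb : Balanced ℂ D)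
      (ha : Absorbent ℝ D), ∃ i, q i = gaugeSeminorm hb hc ha) : IsPseudosaturated X := by
  have := hq.topologicalAddGroup
  have := hq.continuousSMul
  intro D hcl hc hb hD
  have ha := hD.absorbent hc hb
  obtain ⟨i, hi⟩ := h D hcl hD hc hb ha
  exact mem_nhds_of_continuous_gauge hc hb ha (hi ▸ hq.continuous_seminorm i)

/-- The gauge of `D` is continuous along a map; version with explicit topologies. -/
theorem IsPseudosaturated.continuous_gauge_comp' {A X : Type*} [AddCommGroup A] [Module ℂ A]
    {s : TopologicalSpace A} (hg : IsTopologicalAddGroup A) (hm : ContinuousSMul ℂ A)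
    [AddCommGroup X] [Module ℂ X] {s' : TopologicalSpace X} (hm' : ContinuousSMul ℂ X)
    (hA : IsPseudosaturated A) {D : Set X} (hcl : IsClosed D) (hD : IsCapacious D)
    (hc : Convex ℝ D) (hb : Balanced ℂ D) (ha : Absorbent ℝ D) (f : A →ₗ[ℂ] X)
    (hf : Continuous f) :
    Continuous ((gaugeSeminorm hb hc ha).comp f : Seminorm ℂ A) :=
  hA.continuous_gauge_comp hD hcl hc hb ha ⟨f, hf⟩

theorem isPseudosaturated_pseudosatTopology (t : TopologicalSpace X) :
    @IsPseudosaturated X _ (pseudosatTopology t) _ := by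
  refine isPseudosaturated_of_withSeminorms (withSeminorms_pseudosat t)
    fun D hcl hD hc hb ha => ⟨⟨gaugeSeminorm hb hc ha, fun s hs => ?_⟩, rfl⟩
  exact IsPseudosaturated.continuous_gauge_comp' (s := s) (s' := pseudosatTopology t)
    hs.isTopologicalAddGroup (continuousSMul_of_withSeminorms hs.locallyConvex.withSeminorms')
    (continuousSMul_of_withSeminorms (withSeminorms_pseudosat t))
    hs.pseudosaturated hcl hD hc hb ha LinearMap.id
    (continuous_id_iff_le.2 hs.le_pseudosatTopology)

/-- The topology of the pseudosaturation is the coarsest pseudosaturated refinement. -/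
theorem isCoarsest_pseudosatTopology {t : TopologicalSpace X} (ht : PolynormableSpace ℂ X) :
    IsPseudosaturatedRefinement t (pseudosatTopology t) ∧
      ∀ s : TopologicalSpace X, IsPseudosaturatedRefinement t s → s ≤ pseudosatTopology t :=
  ⟨⟨pseudosatTopology_le ht,
    @WithSeminorms.toPolynormableSpace _ _ _ _ _ _ (_) _ (withSeminorms_pseudosat t),
    isPseudosaturated_pseudosatTopology t⟩, fun _ hs => hs.le_pseudosatTopology⟩

/-- A linear map from a pseudosaturated space that is continuous into `X` is continuous for the
topology of the pseudosaturation. -/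
theorem continuous_pseudosatTopology {t : TopologicalSpace X} (ht : PolynormableSpace ℂ X)
    {A : Type*} [AddCommGroup A] [Module ℂ A] [TopologicalSpace A] [IsTopologicalAddGroup A]
    [ContinuousSMul ℂ A] (hA : IsPseudosaturated A) (f : A →ₗ[ℂ] X)
    (hft : Continuous f) :
    @Continuous A X _ (pseudosatTopology t) f := by
  have htq := ht.withSeminorms'
  let q : SeminormFamily ℂ X {p : Seminorm ℂ X // Continuous (p.comp f)} := fun p => p.1
  obtain ⟨s, hq⟩ : ∃ s : TopologicalSpace X, WithSeminorms (topology := s) q :=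
    ⟨q.moduleFilterBasis.topology, @WithSeminorms.mk _ _ _ _ _ _ q (_) rfl⟩
  have hgrp := isTopologicalAddGroup_of_withSeminorms hq
  have hsmul := continuousSMul_of_withSeminorms hq
  have hf : @Continuous A X _ s f :=
    continuous_of_withSeminorms inferInstance hq f fun p => p.2
  have hs : IsPseudosaturatedRefinement t s := by
    refine ⟨?_, ?_, ?_⟩
    · exact continuous_id_iff_le.1 <| continuous_of_withSeminorms hgrp
        htq LinearMap.id fun p =>
          continuous_seminorm_of_withSeminorms hq ⟨p.1, @Continuous.comp A X ℝ _ t _ f p.1 p.2 hft⟩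
    · exact @WithSeminorms.toPolynormableSpace _ _ _ _ _ _ s _ hq
    · exact isPseudosaturated_of_withSeminorms hq fun D hcl hD hc hb ha =>
        ⟨⟨gaugeSeminorm hb hc ha, IsPseudosaturated.continuous_gauge_comp' inferInstance
          inferInstance hsmul hA hcl hD hc hb ha
          f hf⟩, rfl⟩
  exact @Continuous.comp _ _ _ _ s (pseudosatTopology t) _ id
    (continuous_id_iff_le.2 hs.le_pseudosatTopology) hf

/-- The pseudosaturation `X^△` of a locally convex space `X`: the same vector space with the coarsest
pseudosaturated locally convex topology finer than the original one. -/
def Pseudosat (X : Type*) : Type _ := X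

namespace Pseudosat

variable (X : Type*) [AddCommGroup X] [Module ℂ X]

instance : AddCommGroup (Pseudosat X) := inferInstanceAs (AddCommGroup X)

instance : Module ℂ (Pseudosat X) := inferInstanceAs (Module ℂ X)

instance [t : TopologicalSpace X] : TopologicalSpace (Pseudosat X) := pseudosatTopology t

instance [TopologicalSpace X] : IsTopologicalAddGroup (Pseudosat X) :=
  isTopologicalAddGroup_of_withSeminorms (withSeminorms_pseudosat _)

instance [TopologicalSpace X] : ContinuousSMul ℂ (Pseudosat X) :=
  continuousSMul_of_withSeminorms (withSeminorms_pseudosat _)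

instance [t : TopologicalSpace X] : PolynormableSpace ℂ (Pseudosat X) :=
  @WithSeminorms.toPolynormableSpace _ _ _ _ _ _ (_) _ (withSeminorms_pseudosat t)

theorem isPseudosaturated [t : TopologicalSpace X] : IsPseudosaturated (Pseudosat X) :=
  isPseudosaturated_pseudosatTopology t

/-- The natural map `△_X : X^△ → X`, which is the identity on vectors. -/
def toBase [t : TopologicalSpace X] [PolynormableSpace ℂ X] : Pseudosat X →L[ℂ] X where
  toLinearMap := (LinearMap.id : X →ₗ[ℂ] X)
  cont := continuous_id_iff_le.2 (pseudosatTopology_le (t := t) inferInstance)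

variable {X}

/-- The universal property: a continuous linear map from a pseudosaturated space `A` to `X`,
considered as a map to `X^△`. -/
def lift {A : Type*} [AddCommGroup A] [Module ℂ A] [TopologicalSpace A] [IsTopologicalAddGroup A]
    [ContinuousSMul ℂ A] [TopologicalSpace X] [PolynormableSpace ℂ X] (hA : IsPseudosaturated A)
    (f : A →L[ℂ] X) : A →L[ℂ] Pseudosat X where
  toLinearMap := f.toLinearMap
  cont := continuous_pseudosatTopology inferInstance hA f.toLinearMap f.continuous

/-- The pseudosaturation `φ^△ : A^△ → X^△` of a continuous linear map `φ : A → X`. -/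
def map {A : Type*} [AddCommGroup A] [Module ℂ A] [TopologicalSpace A] [PolynormableSpace ℂ A]
    [TopologicalSpace X] [PolynormableSpace ℂ X] (φ : A →L[ℂ] X) : Pseudosat A →L[ℂ] Pseudosat X :=
  lift (isPseudosaturated A) (φ.comp (toBase A))

/-- The naturality square that characterizes `φ^△`. -/
theorem toBase_map {A : Type*} [AddCommGroup A] [Module ℂ A] [TopologicalSpace A]
    [PolynormableSpace ℂ A] [TopologicalSpace X] [PolynormableSpace ℂ X] (φ : A →L[ℂ] X)
    (a : Pseudosat A) : toBase X (map φ a) = φ (toBase A a) := rfl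

end Pseudosat

end Pseudosaturation

noncomputable section Operators

open scoped ComplexOrder in
theorem locallyConvexSpace_of_polynormableSpace (E : Type*) [AddCommGroup E] [Module ℂ E]
    [TopologicalSpace E] [IsTopologicalAddGroup E] [PolynormableSpace ℂ E] :
    LocallyConvexSpace ℂ E := by
  have := (PolynormableSpace.withSeminorms ℂ E).toLocallyConvexSpace
  exact LocallyConvexSpace.ofBasisZero ℂ E id _ (LocallyConvexSpace.convex_basis_zero ℝ E)
    fun s hs => convex_of_nonneg_surjective_algebraMap _
      (fun _ h => RCLike.nonneg_iff_exists_ofReal.mp h) hs.2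

open scoped ComplexOrder in
theorem polynormableSpace_of_locallyConvexSpace (E : Type*) [AddCommGroup E] [Module ℂ E]
    [TopologicalSpace E] [IsTopologicalAddGroup E] [ContinuousSMul ℂ E] [LocallyConvexSpace ℂ E] :
    PolynormableSpace ℂ E :=
  have : ContinuousSMul ℝ E := IsScalarTower.continuousSMul ℂ
  LocallyConvexSpace.toPolynormableSpace

open scoped ComplexOrder in
theorem polynormableSpace_uniformConvergence {E F : Type*} [AddCommGroup E] [Module ℂ E]
    [TopologicalSpace E] [AddCommGroup F] [Module ℂ F] [TopologicalSpace F]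
    [IsTopologicalAddGroup F] [ContinuousSMul ℂ F] [PolynormableSpace ℂ F] (𝔖 : Set (Set E))
    (h₁ : 𝔖.Nonempty) (h₂ : DirectedOn (· ⊆ ·) 𝔖) (h₃ : ∀ S ∈ 𝔖, Bornology.IsVonNBounded ℂ S) :
    PolynormableSpace ℂ (UniformConvergenceCLM (RingHom.id ℂ) F 𝔖) :=
  have := UniformConvergenceCLM.continuousSMul (RingHom.id ℂ) F 𝔖 h₃
  have := locallyConvexSpace_of_polynormableSpace F
  have := UniformConvergenceCLM.locallyConvexSpace ℂ (σ := RingHom.id ℂ) (F := F) 𝔖 h₁ h₂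
  polynormableSpace_of_locallyConvexSpace _

section Dual

variable (X : Type*) [AddCommGroup X] [TopologicalSpace X]

/-- The family of totally bounded subsets of `X`. -/
def totBoundedSets : Set (Set X) := {S | IsTotBounded S}

theorem directedOn_totBoundedSets : DirectedOn (· ⊆ ·) (totBoundedSets X) :=
  directedOn_of_sup_mem fun _ _ hS hT => IsTotBounded.union hS hT

theorem totBoundedSets_nonempty : (totBoundedSets X).Nonempty :=
  ⟨∅, fun _ _ => ⟨∅, Set.finite_empty, Set.empty_subset _⟩⟩

variable [Module ℂ X]

/-- The dual space `X^⋆`: continuous linear functionals with the topology of uniform convergence on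
totally bounded sets. -/
abbrev SDual : Type _ := UniformConvergenceCLM (RingHom.id ℂ) ℂ (totBoundedSets X)

/-- The polar `U° ⊆ X^⋆` of a set `U ⊆ X`. -/
def polar (U : Set X) : Set (SDual X) := {f | ∀ x ∈ U, ‖f x‖ ≤ 1}

/-- The polars in `X^⋆` of the neighbourhoods of zero of `X`. -/
def nhdsPolars : Set (Set (SDual X)) := {A | ∃ U ∈ 𝓝 (0 : X), A = polar X U}

theorem nhdsPolars_nonempty : (nhdsPolars X).Nonempty := ⟨_, univ, univ_mem, rfl⟩

theorem directedOn_nhdsPolars : DirectedOn (· ⊆ ·) (nhdsPolars X) := by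
  rintro _ ⟨U, hU, rfl⟩ _ ⟨V, hV, rfl⟩
  exact ⟨_, ⟨U ∩ V, inter_mem hU hV, rfl⟩, fun f hf x hx => hf x hx.1, fun f hf x hx => hf x hx.2⟩

variable (Y : Type*) [AddCommGroup Y] [Module ℂ Y] [TopologicalSpace Y] [IsTopologicalAddGroup Y]

/-- The space `Y : X` of continuous linear maps `X → Y` with the topology of uniform convergence on
totally bounded sets (arguments in the order `X`, `Y`). -/
abbrev PrimaryFraction : Type _ := UniformConvergenceCLM (RingHom.id ℂ) Y (totBoundedSets X)

/-- The primary tensor product `X · Y`: the space of continuous linear maps `X^⋆ → Y` with the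
topology of uniform convergence on polars of neighbourhoods of zero of `X`. -/
abbrev PrimaryTensor : Type _ := UniformConvergenceCLM (RingHom.id ℂ) Y (nhdsPolars X)

/-- The stereotype fraction `Y ⊘ X = (Y : X)^△` (arguments in the order `X`, `Y`). -/
abbrev StereotypeFraction [ContinuousSMul ℂ Y] : Type _ := Pseudosat (PrimaryFraction X Y)

/-- The injective stereotype tensor product `X ⊙ Y = Y ⊘ X^⋆`. -/
abbrev InjectiveTensor [ContinuousSMul ℂ Y] : Type _ := StereotypeFraction (SDual X) Y

end Dual

section Instances

variable {X : Type*} [AddCommGroup X] [Module ℂ X] [TopologicalSpace X] [IsTopologicalAddGroup X]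
  [ContinuousSMul ℂ X]
  {Y : Type*} [AddCommGroup Y] [Module ℂ Y] [TopologicalSpace Y] [IsTopologicalAddGroup Y]
  [ContinuousSMul ℂ Y]

theorem isVonNBounded_of_mem_totBoundedSets {S : Set X} (hS : S ∈ totBoundedSets X) :
    Bornology.IsVonNBounded ℂ S :=
  IsTotBounded.isVonNBounded hS

/-- The topology of `Y : X` is a vector topology. -/
instance : ContinuousSMul ℂ (PrimaryFraction X Y) :=
  UniformConvergenceCLM.continuousSMul _ _ _ fun _ => isVonNBounded_of_mem_totBoundedSets

instance [PolynormableSpace ℂ Y] : PolynormableSpace ℂ (PrimaryFraction X Y) :=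
  polynormableSpace_uniformConvergence _ (totBoundedSets_nonempty X) (directedOn_totBoundedSets X)
    fun _ => isVonNBounded_of_mem_totBoundedSets

theorem isVonNBounded_polar {U : Set X} (hU : U ∈ 𝓝 (0 : X)) :
    Bornology.IsVonNBounded ℂ (polar X U) := by
  refine UniformConvergenceCLM.isVonNBounded_iff.2 fun S hS => ?_
  have hSU := (isVonNBounded_of_mem_totBoundedSets hS hU).eventually_nhdsNE_zero
  obtain ⟨c, hc, hc0⟩ := (hSU.and eventually_mem_nhdsWithin).exists
  have hc0' : 0 < ‖c‖ := norm_pos_iff.2 hc0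
  refine (NormedSpace.isVonNBounded_iff' ℂ).2 ⟨‖c‖⁻¹, ?_⟩
  rintro _ ⟨f, hf, x, hx, rfl⟩
  have h := hf _ (hc hx)
  rw [map_smul, norm_smul] at h
  rwa [← one_div, le_div_iff₀ hc0', mul_comm]

instance : ContinuousSMul ℂ (PrimaryTensor X Y) :=
  UniformConvergenceCLM.continuousSMul _ _ _ (by
    rintro _ ⟨U, hU, rfl⟩
    exact isVonNBounded_polar hU)

instance [PolynormableSpace ℂ Y] : PolynormableSpace ℂ (PrimaryTensor X Y) :=
  polynormableSpace_uniformConvergence _ (nhdsPolars_nonempty X) (directedOn_nhdsPolars X) (by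
    rintro _ ⟨U, hU, rfl⟩
    exact isVonNBounded_polar hU)

end Instances

section Maps

variable {X X' : Type*} [AddCommGroup X] [Module ℂ X] [TopologicalSpace X]
  [AddCommGroup X'] [Module ℂ X'] [TopologicalSpace X']
  {Y Y' : Type*} [AddCommGroup Y] [Module ℂ Y] [TopologicalSpace Y] [IsTopologicalAddGroup Y]
  [ContinuousSMul ℂ Y] [AddCommGroup Y'] [Module ℂ Y'] [TopologicalSpace Y']
  [IsTopologicalAddGroup Y'] [ContinuousSMul ℂ Y']

/-- The dual map `α^⋆ : X^⋆ → X'^⋆`, `f ↦ f ∘ α`, of an operator `α : X' → X`. -/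
def SDual.map (α : X' →L[ℂ] X) : SDual X →L[ℂ] SDual X' :=
  α.precompUniformConvergenceCLM ℂ (totBoundedSets X') (totBoundedSets X)
    fun _ hS => IsTotBounded.image hS α.toLinearMap.toAddMonoidHom α.continuous

/-- The map `ψ ↦ β ∘ ψ ∘ α^⋆` as a linear map. -/
def PrimaryTensor.mapLinear (α : X' →L[ℂ] X) (β : Y' →L[ℂ] Y) :
    PrimaryTensor X' Y' →ₗ[ℂ] PrimaryTensor X Y where
  toFun ψ := ContinuousLinearMap.toUniformConvergenceCLM _ _ _
    (β ∘L ((ContinuousLinearMap.toUniformConvergenceCLM _ _ _).symm ψ) ∘L SDual.map α)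
  map_add' _ _ := UniformConvergenceCLM.ext _ _ fun _ => map_add β _ _
  map_smul' c _ := UniformConvergenceCLM.ext _ _ fun _ => map_smul β c _

theorem PrimaryTensor.continuous_mapLinear (α : X' →L[ℂ] X) (β : Y' →L[ℂ] Y) :
    Continuous (PrimaryTensor.mapLinear α β) := by
  refine continuous_of_tendsto_nhds_zero _ ?_
  rw [UniformConvergenceCLM.nhds_zero_eq (σ := RingHom.id ℂ) (F := Y)]
  simp only [tendsto_iInf, tendsto_principal]
  rintro _ ⟨U, hU, rfl⟩ V hV
  have hU' : α ⁻¹' U ∈ 𝓝 (0 : X') := α.continuous.continuousAt.preimage_mem_nhds (by simpa using hU)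
  have hV' : β ⁻¹' V ∈ 𝓝 (0 : Y') := β.continuous.continuousAt.preimage_mem_nhds (by simpa using hV)
  filter_upwards [UniformConvergenceCLM.eventually_nhds_zero_mapsTo (RingHom.id ℂ)
    (𝔖 := nhdsPolars X') ⟨_, hU', rfl⟩ hV'] with ψ hψ f hf
  exact hψ (x := SDual.map α f) fun x hx => hf (α x) hx

/-- The map `α · β : X' · Y' → X · Y`, `ψ ↦ β ∘ ψ ∘ α^⋆`. -/
def PrimaryTensor.map (α : X' →L[ℂ] X) (β : Y' →L[ℂ] Y) :
    PrimaryTensor X' Y' →L[ℂ] PrimaryTensor X Y :=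
  ⟨PrimaryTensor.mapLinear α β, PrimaryTensor.continuous_mapLinear α β⟩

theorem PrimaryTensor.map_apply (α : X' →L[ℂ] X) (β : Y' →L[ℂ] Y) (ψ : PrimaryTensor X' Y')
    (f : SDual X) : PrimaryTensor.map α β ψ f = β (ψ (SDual.map α f)) := rfl

end Maps

section Stereotype

variable (X : Type*) [AddCommGroup X] [Module ℂ X] [TopologicalSpace X]

theorem isTotBounded_singleton {X : Type*} [AddCommGroup X] [TopologicalSpace X] (x : X) :
    IsTotBounded ({x} : Set X) := fun U hU =>
  ⟨{x}, Set.finite_singleton _, by simpa using mem_of_mem_nhds hU⟩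

theorem continuous_eval (x : X) : Continuous fun f : SDual X => f x :=
  (UniformConvergenceCLM.continuousEvalConst (RingHom.id ℂ) ℂ (totBoundedSets X)
    (Set.eq_univ_of_forall fun x => ⟨{x}, isTotBounded_singleton x, rfl⟩)).continuous_eval_const x

/-- The canonical map `i_X : X → X^⋆⋆`, `x ↦ (f ↦ f x)`. -/
def evalMap : X →ₗ[ℂ] SDual (SDual X) where
  toFun x := ContinuousLinearMap.toUniformConvergenceCLM _ _ _
    { toFun := fun f : SDual X => f x
      map_add' := fun _ _ => rfl
      map_smul' := fun _ _ => rfl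
      cont := continuous_eval X x }
  map_add' x y := UniformConvergenceCLM.ext _ _ fun f => map_add f x y
  map_smul' c x := UniformConvergenceCLM.ext _ _ fun f => map_smul f c x

theorem evalMap_apply (x : X) (f : SDual X) : evalMap X x f = f x := rfl

/-- `X` is stereotype if `i_X : X → X^⋆⋆` is an isomorphism of topological vector spaces. -/
def IsStereotype : Prop := IsHomeomorph (evalMap X)

end Stereotype

end Operators

end Stereotype

open Stereotype

/-! The source of everything is that pseudosaturation changes neither the totally bounded sets nor
convergence to zero on them. The seminorms that are continuous at zero on every totally bounded set
generate a refinement that is itself pseudosaturated, because the gauge of a capacious set closed in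
that refinement is again such a seminorm (`tendsto_gauge_of_isCapacious`,
`isPseudosaturatedRefinement_of_withSeminorms`). In particular `X^△` inherits pseudocompleteness
from `X`.

The duality rests on `exists_finite_net_swap`: polars of neighbourhoods of zero are totally bounded,
and prepolars of totally bounded sets are capacious. If `X` is pseudocomplete, a Mackey–Arens
argument represents each functional on `X^⋆` by a point of `X`, and `X^⋆` is pseudosaturated. If `X`
is also pseudosaturated, evaluation is a homeomorphism. Then the totally bounded sets of `X^⋆` are
exactly the subsets of polars, so `Y : X^⋆` and `X · Y` have the same topology.

The inverse of `(△_X · △_Y)^△` must turn an operator `X^⋆ → Y` into an operator `(X^△)^⋆ → Y^△`. The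
target lifts to `Y^△` because `X^⋆` is pseudosaturated; the source is treated by transposing,
lifting the new target `X` to `X^△`, and transposing back. The real content is continuity of `(X ·
Y)^△ → X · Y^△`. For this, keep only those seminorms `p` on `Y` whose suprema over a polar, `φ ↦ sup
p(φ f)`, are also continuous at zero on `(X · Y)^△`. The family still generates a pseudosaturated
refinement: for a capacious `D` closed in it, the operators mapping the polar into `εD` form a
closed convex balanced capacious set, hence a neighbourhood of zero. That refinement is finer than
`Y^△`. -/

namespace Stereotype

/-- Exchange of the variables in a total boundedness condition: if the functions `b s`, `s ∈ A`, are
totally bounded for the uniform norm on `B`, then so are the functions `s ↦ b s t`, `t ∈ B`, for the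
uniform norm on `A`. -/
theorem exists_finite_net_swap {S T : Type*} {b : S → T → ℂ} {A : Set S} {B : Set T}
    (hA : ∀ ε > 0, ∃ F : Set S, F.Finite ∧ ∀ s ∈ A, ∃ s' ∈ F, ∀ t ∈ B, ‖b s t - b s' t‖ ≤ ε)
    (hb : ∀ s, ∃ C, ∀ t ∈ B, ‖b s t‖ ≤ C) {ε : ℝ} (hε : 0 < ε) :
    ∃ G ⊆ B, G.Finite ∧ ∀ t ∈ B, ∃ t' ∈ G, ∀ s ∈ A, ‖b s t - b s t'‖ ≤ ε := by
  obtain ⟨F, hF, hFA⟩ := hA (ε / 3) (by positivity)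
  have := hF.fintype
  let Φ : T → F → ℂ := fun t s => b s t
  choose C hC using hb
  -- Only finitely many functions `b s` remain, each bounded on `B`, so `B` is mapped into a compact
  -- polydisc.
  have hΦ : TotallyBounded (Φ '' B) := by
    have : TotallyBounded (Set.univ.pi fun s : F => Metric.closedBall (0 : ℂ) (C s)) :=
      (isCompact_univ_pi fun s => isCompact_closedBall _ _).totallyBounded
    refine this.subset ?_
    rintro _ ⟨t, ht, rfl⟩ s -
    exact mem_closedBall_zero_iff.2 (hC s t ht)
  obtain ⟨G, hGB, hG, hcov⟩ := exists_subset_image_finite_and.1 <| totallyBounded_iff_subset.1 hΦ _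
    (Metric.dist_mem_uniformity (show (0 : ℝ) < ε / 3 by positivity))
  refine ⟨G, hGB, hG, fun t ht => ?_⟩
  obtain ⟨_, ⟨t', ht', rfl⟩, hty⟩ := mem_iUnion₂.1 (hcov ⟨t, ht, rfl⟩)
  refine ⟨t', ht', fun s hs => ?_⟩
  obtain ⟨s', hs', hss'⟩ := hFA s hs
  have h1 := hss' t ht
  have h2 := hss' t' (hGB ht')
  have h3 : ‖b s' t - b s' t'‖ < ε / 3 := by
    have := (dist_le_pi_dist (Φ t) (Φ t') ⟨s', hs'⟩).trans_lt hty
    rwa [dist_eq_norm] at this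
  calc ‖b s t - b s t'‖ = ‖(b s t - b s' t) + (b s' t - b s' t') - (b s t' - b s' t')‖ := by
        congr 1; ring
    _ ≤ ‖b s t - b s' t‖ + ‖b s' t - b s' t'‖ + ‖b s t' - b s' t'‖ :=
        (norm_sub_le _ _).trans (add_le_add_left (norm_add_le _ _) _)
    _ ≤ ε := by linarith

/-! ### Hahn–Banach separation and compact hulls -/

section LocallyConvex

variable {X : Type*} [AddCommGroup X] [Module ℂ X] [TopologicalSpace X] [IsTopologicalAddGroup X]

theorem exists_seminorm_closedBall_subset [PolynormableSpace ℂ X] {U : Set X} (hU : U ∈ 𝓝 (0 : X)) :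
    ∃ p : Seminorm ℂ X, Continuous p ∧ {x | p x ≤ 1} ⊆ U := by
  have hw := PolynormableSpace.withSeminorms ℂ X
  obtain ⟨s, r, hr, hs⟩ := (hw.mem_nhds_iff 0 U).1 hU
  set q : Seminorm ℂ X := s.sup fun p : {p : Seminorm ℂ X // Continuous p} => p.1
  have hq : Continuous q := Seminorm.continuous_finsetSup fun i _ => i.2
  -- The factor `2 / r` makes the closed unit ball lie in `q ≤ r / 2`, strictly inside the open ball
  -- of radius `r`.
  refine ⟨Real.toNNReal (2 / r) • q, hq.const_smul (Real.toNNReal (2 / r)), fun x hx => hs ?_⟩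
  rw [Seminorm.mem_ball_zero]
  have hx' : Real.toNNReal (2 / r) * q x ≤ 1 := hx
  rw [Real.coe_toNNReal _ (by positivity)] at hx'
  rw [div_mul_eq_mul_div, div_le_one hr] at hx'
  linarith [apply_nonneg q x]

theorem exists_functional_separating [ContinuousSMul ℂ X]
    [PolynormableSpace ℂ X] {D : Set X} (hcl : IsClosed D) (hc : Convex ℝ D) (hb : Balanced ℂ D)
    (h0 : (0 : X) ∈ D) {x : X} (hx : x ∉ D) :
    ∃ f : X →L[ℂ] ℂ, (∀ y ∈ D, ‖f y‖ ≤ 1) ∧ 1 < ‖f x‖ := by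
  have : ContinuousSMul ℝ X := IsScalarTower.continuousSMul ℂ
  have := (PolynormableSpace.withSeminorms ℂ X).toLocallyConvexSpace
  obtain ⟨l, u, hlD, hlx⟩ := RCLike.geometric_hahn_banach_closed_point (𝕜 := ℂ) hc hcl hx
  have hu : 0 < u := by simpa using hlD 0 h0
  have hle : ∀ y ∈ D, ‖l y‖ ≤ u := by
    intro y hy
    -- Hahn–Banach bounds only the real part of `l`; rotating `y` inside the balanced set `D` bounds
    -- the modulus.
    obtain ⟨c, hc, hcy⟩ := RCLike.exists_norm_eq_mul_self (l y)
    have := hlD (c • y) (hb.smul_mem hc.le hy)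
    rw [map_smul, smul_eq_mul, ← hcy] at this
    simpa using this.le
  refine ⟨(u⁻¹ : ℂ) • l, fun y hy => ?_, ?_⟩
  · rw [_root_.smul_apply, norm_smul, norm_inv, Complex.norm_real, Real.norm_of_nonneg hu.le,
      inv_mul_le_one₀ hu]
    exact hle y hy
  · rw [_root_.smul_apply, norm_smul, norm_inv, Complex.norm_real, Real.norm_of_nonneg hu.le,
      one_lt_inv_mul₀ hu]
    exact hlx.trans_le (RCLike.re_le_norm _)

variable [ContinuousSMul ℂ X] [PolynormableSpace ℂ X]

theorem exists_functional_of_one_lt (p : Seminorm ℂ X) (hp : Continuous p)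
    {x : X} (hx : 1 < p x) : ∃ f : X →L[ℂ] ℂ, (∀ y, p y ≤ 1 → ‖f y‖ ≤ 1) ∧ 1 < ‖f x‖ := by
  have h : p.closedBall 0 1 = {y | p y ≤ 1} := p.closedBall_zero_eq
  exact exists_functional_separating (D := {y | p y ≤ 1}) (isClosed_le hp continuous_const)
    (h ▸ p.convex_closedBall 0 1) (h ▸ p.balanced_closedBall_zero 1) (by simp) (by simpa using hx)

theorem eq_of_forall_functional_eq [T2Space X] {x y : X} (h : ∀ f : X →L[ℂ] ℂ, f x = f y) :
    x = y := by
  have : ContinuousSMul ℝ X := IsScalarTower.continuousSMul ℂ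
  have := (PolynormableSpace.withSeminorms ℂ X).toLocallyConvexSpace
  by_contra hxy
  obtain ⟨f, hf⟩ := RCLike.geometric_hahn_banach_point_point (𝕜 := ℂ) hxy
  exact hf.ne (by rw [h])

/-- In a pseudocomplete space, every totally bounded set is contained in a compact convex balanced
set. -/
theorem IsTotBounded.exists_isCompact [T2Space X] (hX : IsPseudocomplete X) {S : Set X}
    (hS : IsTotBounded S) :
    ∃ K, S ⊆ K ∧ IsCompact K ∧ Convex ℝ K ∧ Balanced ℂ K ∧ (0 : X) ∈ K := by
  have : ContinuousSMul ℝ X := IsScalarTower.continuousSMul ℂ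
  have := (PolynormableSpace.withSeminorms ℂ X).toLocallyConvexSpace
  let _ := IsTopologicalAddGroup.rightUniformSpace X
  have _ : IsUniformAddGroup X := isUniformAddGroup_of_addCommGroup
  have compl : ∀ T : Set X, TotallyBounded T → IsCompact (closure T) := by
    intro T hT
    refine isCompact_iff_totallyBounded_isComplete.2 ⟨hT.closure, fun l hl hTl => ?_⟩
    have hTl' : closure T ∈ l := le_principal_iff.1 hTl
    obtain ⟨x, hx⟩ := hX (closure T) ((isTotBounded_iff_totallyBounded _).2 hT.closure) l hl.1
      hTl' (by
        intro U hU
        have := hl.2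
        rw [uniformity_eq_comap_nhds_zero_swapped] at this
        obtain ⟨A, hA, h⟩ := Filter.mem_prod_same_iff.1 (this (preimage_mem_comap hU))
        exact ⟨A, hA, fun x hx y hy => h (Set.mk_mem_prod hx hy)⟩)
    have := hl.1
    exact ⟨x, isClosed_closure.mem_of_tendsto (f := id) (b := l)
      (show Tendsto id l (𝓝 x) from hx) hTl', hx⟩
  -- Multiplying by the unit disc gives a compact balanced hull. Its convex hull is totally bounded,
  -- so closing it loses neither compactness nor balancedness.
  set B : Set X := (fun p : ℂ × X => p.1 • p.2) '' (Metric.closedBall 0 1 ×ˢ closure (insert 0 S))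
  have hBc : IsCompact B := by
    refine ((isCompact_closedBall _ _).prod (compl _ ?_)).image continuous_smul
    exact ((isTotBounded_iff_totallyBounded S).1 hS).insert 0
  have hBb : Balanced ℂ B := by
    rintro c hc _ ⟨_, ⟨⟨d, x⟩, ⟨hd, hx⟩, rfl⟩, rfl⟩
    refine ⟨(c * d, x), ⟨?_, hx⟩, mul_smul _ _ _⟩
    rw [mem_closedBall_zero_iff, norm_mul]
    exact mul_le_one₀ hc (norm_nonneg _) (mem_closedBall_zero_iff.1 hd)
  have hSB : insert 0 S ⊆ B := fun x hx =>
    ⟨(1, x), ⟨by simp, subset_closure hx⟩, one_smul _ _⟩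
  have hBK : B ⊆ closure (convexHull ℝ B) := (subset_convexHull ℝ B).trans subset_closure
  refine ⟨closure (convexHull ℝ B), ((subset_insert 0 S).trans hSB).trans hBK,
    compl _ hBc.totallyBounded.convexHull, (convex_convexHull ℝ B).closure, Balanced.closure ?_,
    hBK (hSB (mem_insert 0 S))⟩
  intro c hc
  have h := ((LinearMap.lsmul ℂ X c).restrictScalars ℝ).image_convexHull B
  change c • convexHull ℝ B = convexHull ℝ (c • B) at h
  rw [h]
  exact convexHull_mono (hBb c hc)

end LocallyConvex
end Stereotype

namespace Stereotype
-- Polars and prepolars: total boundedness against capaciousness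
section Polars

variable {X : Type*} [AddCommGroup X] [Module ℂ X] [TopologicalSpace X]

theorem exists_bound_of_isVonNBounded {B : Set X} (hB : Bornology.IsVonNBounded ℂ B)
    (f : X →L[ℂ] ℂ) : ∃ C, ∀ x ∈ B, ‖f x‖ ≤ C := by
  obtain ⟨C, hC⟩ := (NormedSpace.isVonNBounded_iff' ℂ).1 (hB.image f)
  exact ⟨C, fun x hx => hC _ ⟨x, hx, rfl⟩⟩

theorem setOf_forall_norm_le_mem_nhds {S : Set X} (hS : IsTotBounded S) {ε : ℝ} (hε : 0 < ε) :
    {f : SDual X | ∀ x ∈ S, ‖f x‖ ≤ ε} ∈ 𝓝 0 := by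
  filter_upwards [UniformConvergenceCLM.eventually_nhds_zero_mapsTo (RingHom.id ℂ)
    (𝔖 := totBoundedSets X) hS (Metric.closedBall_mem_nhds (0 : ℂ) hε)] with f hf x hx
  simpa using hf hx

theorem exists_subset_of_mem_nhds_dual {W : Set (SDual X)} (hW : W ∈ 𝓝 0) :
    ∃ S : Set X, IsTotBounded S ∧ ∃ ε > 0, {f : SDual X | ∀ x ∈ S, ‖f x‖ ≤ ε} ⊆ W := by
  obtain ⟨⟨S, ε⟩, ⟨hS, hε⟩, hSW⟩ := (UniformConvergenceCLM.hasBasis_nhds_zero_of_basis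
    (RingHom.id ℂ) ℂ (totBoundedSets X) (totBoundedSets_nonempty X) (directedOn_totBoundedSets X)
    Metric.nhds_basis_closedBall).mem_iff.1 hW
  exact ⟨S, hS, ε, hε, fun f hf => hSW fun x hx => mem_closedBall_zero_iff.2 (hf x hx)⟩

variable (X) in
/-- The prepolar `T_° ⊆ X` of a set `T ⊆ X^⋆`. -/
def prepolar (T : Set (SDual X)) : Set X := {x | ∀ f ∈ T, ‖f x‖ ≤ 1}

theorem isClosed_prepolar (T : Set (SDual X)) : IsClosed (prepolar X T) := by
  simp only [prepolar, ofPred_forall]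
  exact isClosed_biInter fun f _ => isClosed_le (map_continuous f).norm continuous_const

theorem balanced_prepolar (T : Set (SDual X)) : Balanced ℂ (prepolar X T) := by
  rintro c hc _ ⟨x, hx, rfl⟩ f hf
  simp only [map_smul, norm_smul]
  exact mul_le_one₀ hc (norm_nonneg _) (hx f hf)

theorem convex_prepolar (T : Set (SDual X)) : Convex ℝ (prepolar X T) := by
  intro x hx y hy a b ha hb hab f hf
  rw [← Complex.coe_smul, ← Complex.coe_smul, map_add, map_smul, map_smul]
  exact convex_closedBall (0 : ℂ) 1 (mem_closedBall_zero_iff.2 (hx f hf))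
    (mem_closedBall_zero_iff.2 (hy f hf)) ha hb hab |> mem_closedBall_zero_iff.1

variable [IsTopologicalAddGroup X] [ContinuousSMul ℂ X]

/-- A cover of `S` by translates of `δU` approximates `S` within `δ` uniformly on the polar;
exchanging variables gives a finite net of the polar, uniform on `S`. -/
theorem isTotBounded_polar {U : Set X} (hU : U ∈ 𝓝 (0 : X)) : IsTotBounded (polar X U) := by
  intro W hW
  obtain ⟨S, hS, ε, hε, hSW⟩ := exists_subset_of_mem_nhds_dual hW
  obtain ⟨G, -, hG, hcov⟩ := exists_finite_net_swap (b := fun (x : X) (f : SDual X) => f x) (A := S)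
    (B := polar X U) (fun δ hδ => by
      have hδ' : (δ : ℂ) ≠ 0 := by exact_mod_cast hδ.ne'
      obtain ⟨F, hF, hSF⟩ := hS _ ((set_smul_mem_nhds_zero_iff hδ').2 hU)
      refine ⟨F, hF, fun x hx => ?_⟩
      obtain ⟨a, ha, _, ⟨u, hu, rfl⟩, rfl⟩ := hSF hx
      refine ⟨a, ha, fun f hf => ?_⟩
      simp only [map_add, add_sub_cancel_left, map_smul, norm_smul, Complex.norm_real,
        Real.norm_of_nonneg hδ.le]
      exact mul_le_of_le_one_right hδ.le (hf u hu))
    (fun x => exists_bound_of_isVonNBounded (isVonNBounded_polar hU) (evalMap X x)) hε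
  refine ⟨G, hG, fun f hf => ?_⟩
  obtain ⟨g, hg, hfg⟩ := hcov f hf
  exact ⟨g, hg, f - g, hSW hfg, add_sub_cancel _ _⟩

/-- The same exchange with roles reversed: a finite net of `T`, uniform on `S`, yields a finite net
of `S` with differences in the prepolar. -/
theorem isCapacious_prepolar {T : Set (SDual X)} (hT : IsTotBounded T) :
    IsCapacious (prepolar X T) := by
  intro S hS
  obtain ⟨G, -, hG, hcov⟩ := exists_finite_net_swap (b := fun (f : SDual X) (x : X) => f x) (A := T)
    (B := S) (fun δ hδ => by
      obtain ⟨F, hF, hTF⟩ := hT _ (setOf_forall_norm_le_mem_nhds hS hδ)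
      refine ⟨F, hF, fun f hf => ?_⟩
      obtain ⟨g, hg, h, hh, rfl⟩ := hTF hf
      exact ⟨g, hg, fun x hx => by
        simpa [_root_.add_apply] using hh x hx⟩)
    (fun f => exists_bound_of_isVonNBounded hS.isVonNBounded f) one_pos
  refine ⟨G, hG, fun x hx => ?_⟩
  obtain ⟨y, hy, hxy⟩ := hcov x hx
  exact ⟨x - y, fun f hf => by simpa using hxy f hf, y, hy, sub_add_cancel _ _⟩

theorem IsPseudosaturated.prepolar_mem_nhds (hX : IsPseudosaturated X) {T : Set (SDual X)}
    (hT : IsTotBounded T) : prepolar X T ∈ 𝓝 (0 : X) :=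
  hX _ (isClosed_prepolar T) (convex_prepolar T) (balanced_prepolar T) (isCapacious_prepolar hT)

end Polars

/-! ### Evaluation into the second dual and stereotypy -/

section Duality

variable {X : Type*} [AddCommGroup X] [Module ℂ X] [TopologicalSpace X] [IsTopologicalAddGroup X]
  [ContinuousSMul ℂ X] [PolynormableSpace ℂ X]

theorem exists_prepolar_polar_subset {U : Set X} (hU : U ∈ 𝓝 (0 : X)) :
    ∃ V ∈ 𝓝 (0 : X), prepolar X (polar X V) ⊆ U := by
  obtain ⟨p, hp, hpU⟩ := exists_seminorm_closedBall_subset hU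
  refine ⟨{x | p x ≤ 1}, mem_of_superset ((isOpen_lt hp continuous_const).mem_nhds
    (by simp : p 0 < 1)) fun x hx => le_of_lt (b := (1 : ℝ)) hx, fun x hx => hpU ?_⟩
  by_contra hx'
  obtain ⟨f, hf, hfx⟩ := exists_functional_of_one_lt p hp (not_le.1 hx')
  exact hfx.not_ge (hx f hf)

variable [T2Space X]

theorem evalMap_injective : Function.Injective (evalMap X) := fun _ _ h =>
  eq_of_forall_functional_eq fun f => DFunLike.congr_fun h f

/-- A continuous functional on `X^⋆` is controlled by the supremum over some compact convex balanced
`K`. It is matched on finitely many `f` at a time by points of `K`, and compactness supplies one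
point for all `f`. -/
theorem evalMap_surjective (hX : IsPseudocomplete X) : Function.Surjective (evalMap X) := by
  intro g
  obtain ⟨S, hS, ε, hε, hSg⟩ := exists_subset_of_mem_nhds_dual
    ((map_continuous g).continuousAt.preimage_mem_nhds
      (by simpa using Metric.closedBall_mem_nhds (0 : ℂ) one_pos))
  obtain ⟨K, hSK, hK, hKc, hKb, hK0⟩ := hS.exists_isCompact hX
  have hgK : ∀ (f : SDual X) (u : ℝ), 0 < u → (∀ x ∈ K, ‖f x‖ ≤ u) → ‖g f‖ ≤ u / ε := by
    intro f u hu hf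
    have h : ((ε / u : ℝ) : ℂ) • f ∈ g ⁻¹' Metric.closedBall 0 1 := hSg fun x hx => by
      rw [_root_.smul_apply, norm_smul, Complex.norm_real,
        Real.norm_of_nonneg (by positivity), div_mul_eq_mul_div, div_le_iff₀ hu]
      exact mul_le_mul_of_nonneg_left (hf x (hSK hx)) hε.le
    rw [mem_preimage, mem_closedBall_zero_iff, map_smul, norm_smul, Complex.norm_real,
      Real.norm_of_nonneg (by positivity), div_mul_eq_mul_div, div_le_one hu] at h
    rwa [le_div_iff₀ hε, mul_comm]
  -- The factor `ε` brings `g` under the bound given by `K`. A failure would separate the target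
  -- vector from the compact image of `K` in finite dimension; the separating functional assembles
  -- into `h` with `‖h‖ ≤ 1` on `K` but `‖ε • g h‖ > 1`.
  have key : ∀ F : Finset (SDual X), ∃ x ∈ K, ∀ f ∈ F, f x = ε • g f := by
    classical
    intro F
    let L : X →L[ℂ] (F → ℂ) := ContinuousLinearMap.pi fun f => f.1
    by_contra! hne
    have hv : (fun f : F => ε • g f) ∉ L '' K := by
      rintro ⟨x, hx, hLx⟩
      obtain ⟨f, hf, hfx⟩ := hne x hx
      exact hfx (congr_fun hLx ⟨f, hf⟩)
    obtain ⟨l, hl, hlv⟩ := exists_functional_separating (D := L '' K)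
      (hK.image L.continuous).isClosed (hKc.is_linear_image (L.restrictScalars ℝ).isLinear)
      (by
        rintro c hc _ ⟨_, ⟨x, hx, rfl⟩, rfl⟩
        exact ⟨c • x, hKb.smul_mem hc hx, map_smul _ _ _⟩)
      ⟨0, hK0, map_zero _⟩ hv
    let h : SDual X := ∑ f : F, l (Pi.single f 1) • f.1
    have hl_eq : ∀ v : F → ℂ, l v = ∑ f : F, l (Pi.single f 1) * v f := by
      intro v
      conv_lhs => rw [← Finset.univ_sum_single v, map_sum]
      refine Finset.sum_congr rfl fun f _ => ?_
      rw [mul_comm, ← smul_eq_mul, ← map_smul, ← Pi.single_smul', smul_eq_mul, mul_one]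
    have hh : ∀ x, h x = l (L x) := by
      intro x
      rw [hl_eq]
      exact map_sum (evalMap X x) _ _ |>.trans
        (Finset.sum_congr rfl fun f _ => map_smul (evalMap X x) _ _)
    have h1 := hgK h 1 one_pos fun x hx => by
      rw [hh]
      exact hl _ ⟨x, hx, rfl⟩
    have h2 : l (fun f : F => ε • g f) = ε • g h := by
      rw [hl_eq, map_sum, Finset.smul_sum]
      refine Finset.sum_congr rfl fun f _ => ?_
      rw [map_smul, smul_eq_mul, mul_smul_comm]
    rw [h2, norm_smul, Real.norm_of_nonneg hε.le] at hlv
    rw [le_div_iff₀ hε, mul_comm] at h1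
    exact hlv.not_ge h1
  obtain ⟨x, hx⟩ : (K ∩ ⋂ f : SDual X, {x | f x = ε • g f}).Nonempty := by
    refine hK.inter_iInter_nonempty _ (fun f => isClosed_eq (map_continuous f) continuous_const)
      fun F => ?_
    obtain ⟨x, hx, hxF⟩ := key F
    exact ⟨x, hx, mem_iInter₂.2 hxF⟩
  refine ⟨((ε⁻¹ : ℝ) : ℂ) • x, UniformConvergenceCLM.ext _ _ fun f => ?_⟩
  have := mem_iInter.1 hx.2 f
  rw [evalMap_apply, map_smul, this, Complex.coe_smul, smul_smul, inv_mul_cancel₀ hε.ne', one_smul]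

end Duality
theorem subset_add_left_of_sub_mem {X : Type*} [AddCommGroup X] {S G U : Set X}
    (h : ∀ x ∈ S, ∃ y ∈ G, x - y ∈ U) : S ⊆ G + U := fun x hx =>
  let ⟨y, hy, hxy⟩ := h x hx
  ⟨y, hy, x - y, hxy, add_sub_cancel _ _⟩

section Duality

variable {X : Type*} [AddCommGroup X] [Module ℂ X] [TopologicalSpace X] [IsTopologicalAddGroup X]
  [ContinuousSMul ℂ X]

theorem continuous_evalMap (hX : IsPseudosaturated X) : Continuous (evalMap X) := by
  refine continuous_of_continuousAt_zero (evalMap X) ?_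
  rw [ContinuousAt, map_zero]
  intro W hW
  obtain ⟨T, hT, ε, hε, hTW⟩ := exists_subset_of_mem_nhds_dual hW
  have hε' : (ε : ℂ) ≠ 0 := by exact_mod_cast hε.ne'
  refine mem_map.2 (mem_of_superset ((set_smul_mem_nhds_zero_iff hε').2 (hX.prepolar_mem_nhds hT)) ?_)
  rintro _ ⟨x, hx, rfl⟩
  refine hTW fun f hf => ?_
  change ‖f ((ε : ℂ) • x)‖ ≤ ε
  rw [map_smul, norm_smul, Complex.norm_real, Real.norm_of_nonneg hε.le]
  exact mul_le_of_le_one_right hε.le (hx f hf)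

variable [PolynormableSpace ℂ X]

/-- This is the openness half of stereotypy. It needs no pseudosaturation: polars are totally
bounded in `X^⋆`, so their bipolars are traces of neighbourhoods of zero in `X^⋆⋆`. -/
theorem comap_evalMap_le : comap (evalMap X) (𝓝 0) ≤ 𝓝 0 := by
  intro U hU
  obtain ⟨V, hV, hVU⟩ := exists_prepolar_polar_subset hU
  exact ⟨_, setOf_forall_norm_le_mem_nhds (isTotBounded_polar hV) one_pos, fun x hx => hVU hx⟩

theorem isStereotype [T2Space X] (hX : IsPseudocomplete X) (hX' : IsPseudosaturated X) :
    IsStereotype X := by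
  refine isHomeomorph_iff_continuous_isClosedMap_bijective.2 ⟨continuous_evalMap hX', ?_,
    evalMap_injective, evalMap_surjective hX⟩
  let e := LinearEquiv.ofBijective (evalMap X) ⟨evalMap_injective, evalMap_surjective hX⟩
  have he : Continuous e.symm := by
    refine continuous_of_continuousAt_zero e.symm ?_
    rw [ContinuousAt, map_zero]
    refine Tendsto.mono_right (tendsto_comap_iff.2 ?_) comap_evalMap_le
    exact tendsto_id.congr fun ξ => (e.apply_symm_apply ξ).symm
  exact (IsClosedMap.of_inverse he e.apply_symm_apply e.symm_apply_apply : IsClosedMap e)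

/-- The dual space of a pseudocomplete space is pseudosaturated. -/
theorem IsPseudocomplete.isPseudosaturated_dual [T2Space X] (hX : IsPseudocomplete X) :
    IsPseudosaturated (SDual X) := by
  intro D hcl hc hb hD
  have h0 := hD.zero_mem hb
  have htb : IsTotBounded (prepolar X D) := by
    intro U hU
    obtain ⟨V, hV, hVU⟩ := exists_prepolar_polar_subset hU
    obtain ⟨G, -, hG, hcov⟩ := exists_finite_net_swap (b := fun (f : SDual X) (x : X) => f x)
      (A := polar X V) (B := prepolar X D) (fun δ hδ => by
        have hδ' : (δ : ℂ) ≠ 0 := by exact_mod_cast hδ.ne'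
        obtain ⟨F, hF, hTF⟩ := hD _ (isTotBounded_polar ((set_smul_mem_nhds_zero_iff hδ').2 hV))
        -- Rescaling the polar of `δV` by `δ` turns a finite cover by translates of `D` into an
        -- approximation within `δ` on the prepolar of `D`.
        refine ⟨(δ : ℂ) • F, hF.image _, fun f hf => ?_⟩
        obtain ⟨d, hd, g, hg, hdg⟩ := hTF (a := (δ : ℂ)⁻¹ • f) (by
          rintro _ ⟨x, hx, rfl⟩
          rw [_root_.smul_apply]
          simp only [map_smul, smul_smul, inv_mul_cancel₀ hδ', one_smul]
          exact hf x hx)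
        refine ⟨(δ : ℂ) • g, ⟨g, hg, rfl⟩, fun x hx => ?_⟩
        have hfx : d x + g x = (δ : ℂ)⁻¹ * f x := DFunLike.congr_fun hdg x
        have : f x - (δ : ℂ) * g x = δ * d x := by
          rw [← eq_sub_iff_add_eq] at hfx
          rw [hfx]
          field_simp
        change ‖f x - (δ : ℂ) * g x‖ ≤ δ
        rw [this, norm_mul, Complex.norm_real, Real.norm_of_nonneg hδ.le]
        exact mul_le_of_le_one_right hδ.le (hx d hd))
      (fun f => by
        obtain ⟨r, hr, hrf⟩ := (hD.absorbent hc hb f).exists_pos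
        have := hrf r (le_abs_self r) rfl
        obtain ⟨d, hd, hdf⟩ := this
        refine ⟨r, fun x hx => ?_⟩
        have hdf' : (r : ℂ) * d x = f x := DFunLike.congr_fun hdf x
        rw [← hdf', norm_mul, Complex.norm_real, Real.norm_of_nonneg hr.le]
        exact mul_le_of_le_one_right hr.le (hx d hd)) one_pos
    exact ⟨G, hG, subset_add_left_of_sub_mem fun x hx =>
      let ⟨y, hy, hxy⟩ := hcov x hx
      ⟨y, hy, hVU fun f hf => by simpa using hxy f hf⟩⟩
  -- By the bipolar argument `D` contains the polar of its prepolar: a separating functional on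
  -- `X^⋆` is evaluation at a point, which lies in that prepolar.
  refine mem_of_superset (setOf_forall_norm_le_mem_nhds htb one_pos) fun f hf => ?_
  by_contra hfD
  obtain ⟨g, hg, hgf⟩ := exists_functional_separating hcl hc hb h0 hfD
  obtain ⟨x, hx⟩ := evalMap_surjective hX (ContinuousLinearMap.toUniformConvergenceCLM _ _ _ g)
  have hgx : ∀ f : SDual X, g f = f x := fun f => (DFunLike.congr_fun hx f).symm
  rw [hgx] at hgf
  exact hgf.not_ge (hf x fun d hd => hgx d ▸ hg d hd)

end Duality
-- Pseudosaturation and totally bounded sets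
section TotBounded

variable {X : Type*} [AddCommGroup X] [TopologicalSpace X] [IsTopologicalAddGroup X]

theorem IsTotBounded.sub {S T : Set X} (hS : IsTotBounded S) (hT : IsTotBounded T) :
    IsTotBounded (S - T) := by
  intro U hU
  obtain ⟨W, hW, hWU⟩ : ∃ W ∈ 𝓝 (0 : X), ∀ v ∈ W, ∀ w ∈ W, v - w ∈ U := exists_nhds_half_neg hU
  obtain ⟨F, hF, hSF⟩ := hS W hW
  obtain ⟨G, hG, hTG⟩ := hT W hW
  refine ⟨F - G, hF.sub hG, ?_⟩
  rintro _ ⟨x, hx, y, hy, rfl⟩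
  obtain ⟨a, ha, w, hw, rfl⟩ := hSF hx
  obtain ⟨b, hb, v, hv, rfl⟩ := hTG hy
  exact ⟨a - b, ⟨a, ha, b, hb, rfl⟩, w - v, hWU w hw v hv, sub_add_sub_comm _ _ _ _⟩

theorem IsTotBounded.exists_finite_subset {S : Set X} (hS : IsTotBounded S) {U : Set X}
    (hU : U ∈ 𝓝 (0 : X)) : ∃ F ⊆ S, F.Finite ∧ ∀ x ∈ S, ∃ y ∈ F, x - y ∈ U := by
  obtain ⟨W, hW, hWU⟩ : ∃ W ∈ 𝓝 (0 : X), ∀ v ∈ W, ∀ w ∈ W, v - w ∈ U := exists_nhds_half_neg hU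
  obtain ⟨F, hF, hSF⟩ := hS W hW
  choose g hg w hw hgw using fun x : S => hSF x.2
  have hfin : (range g).Finite := hF.subset (range_subset_iff.2 hg)
  obtain ⟨T, hT, hTg⟩ : ∃ T : Set S, T.Finite ∧ g '' T = range g := by
    rw [← image_univ] at hfin ⊢
    obtain ⟨T, -, hT, h⟩ := (exists_subset_image_finite_and (f := g) (s := univ)
      (p := fun t => t = g '' univ)).1 ⟨_, subset_rfl, hfin, rfl⟩
    exact ⟨T, hT, h⟩
  refine ⟨(↑) '' T, ?_, hT.image _, fun x hx => ?_⟩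
  · rintro _ ⟨x, -, rfl⟩
    exact x.2
  · obtain ⟨y, hy, hyx⟩ : g ⟨x, hx⟩ ∈ g '' T := hTg ▸ mem_range_self _
    refine ⟨y, ⟨y, hy, rfl⟩, ?_⟩
    have h1 : g ⟨x, hx⟩ + w ⟨x, hx⟩ = x := hgw ⟨x, hx⟩
    have h2 : g y + w y = y := hgw y
    rw [← h1, ← h2, hyx, add_sub_add_left_eq_sub]
    exact hWU _ (hw _) _ (hw _)

/-- If, on totally bounded sets, convergence to zero for `t` implies convergence to zero for `s`,
then the totally bounded sets for `t` are totally bounded for `s`. -/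
theorem IsTotBounded.of_nhds_inf_le {X : Type*} [AddCommGroup X] {t s : TopologicalSpace X}
    (ht : @IsTopologicalAddGroup X t _)
    (hts : ∀ S : Set X, @IsTotBounded X _ t S → @nhds X t 0 ⊓ 𝓟 S ≤ @nhds X s 0)
    {S : Set X} (hS : @IsTotBounded X _ t S) : @IsTotBounded X _ s S := by
  intro V hV
  have hdiff := @IsTotBounded.sub X _ t ht S S hS hS
  have hU := (@mem_inf_principal _ (@nhds X t 0) V (S - S)).1 (hts _ hdiff hV)
  obtain ⟨F, hFS, hF, hcov⟩ := @IsTotBounded.exists_finite_subset X _ t ht S hS _ hU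
  refine ⟨F, hF, subset_add_left_of_sub_mem fun x hx => ?_⟩
  obtain ⟨y, hy, hxy⟩ := hcov x hx
  exact ⟨y, hy, hxy ⟨x, hx, y, hFS hy, rfl⟩⟩

end TotBounded

section Agreement

variable {X : Type*} [AddCommGroup X] [Module ℂ X]

theorem IsTotBounded.smul {S : Set X} [TopologicalSpace X] [ContinuousConstSMul ℂ X]
    (hS : IsTotBounded S) (c : ℂ) : IsTotBounded (c • S) :=
  hS.image (DistribSMul.toAddMonoidHom X c) (continuous_const_smul c)

theorem smul_mem_of_eventually_smul_sub_mem [TopologicalSpace X] [IsTopologicalAddGroup X]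
    [ContinuousConstSMul ℂ X] {D : Set X} (hD : IsClosed D) {l : Filter X} [l.NeBot]
    (hl : l ≤ 𝓝 0) {c : ℂ} {x : X} (h : ∀ᶠ y in l, c • (x - y) ∈ D) : c • x ∈ D := by
  have h1 : Tendsto (fun y : X => c • (x - y)) l (𝓝 (c • (x - 0))) :=
    ((continuous_const_smul c).comp (continuous_const.sub continuous_id)).continuousAt.mono_left hl
  rw [sub_zero] at h1
  exact hD.mem_of_tendsto h1 h

theorem gauge_le_of_inv_smul_mem {D : Set X} {δ : ℝ} (hδ : 0 < δ) {x : X}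
    (h : ((δ⁻¹ : ℝ) : ℂ) • x ∈ D) : gauge D x ≤ δ := by
  refine gauge_le_of_mem hδ.le ⟨_, h, ?_⟩
  simp only [Complex.coe_smul]
  rw [smul_inv_smul₀ hδ.ne']

theorem inv_smul_mem_of_gauge_lt {D : Set X} (hc : Convex ℝ D) (ha : Absorbent ℝ D) {δ : ℝ}
    (hδ : 0 < δ) {x : X} (h : gauge D x < δ) : ((δ⁻¹ : ℝ) : ℂ) • x ∈ D := by
  rw [Complex.coe_smul]
  refine setOfPred_gauge_lt_one_subset_self hc ha.zero_mem ha ?_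
  rw [mem_ofPred_eq, gauge_smul_of_nonneg (by positivity), smul_eq_mul, inv_mul_lt_iff₀ hδ, mul_one]
  exact h

/-- Let `s` be a vector topology such that, on totally bounded sets for `t`, convergence to zero for
`t` implies convergence to zero for `s`. Then the gauges of `s`-closed convex balanced capacious
sets are continuous at zero on totally bounded sets. -/
theorem tendsto_gauge_of_isCapacious {t s : TopologicalSpace X}
    (ht : @ContinuousConstSMul ℂ X t _) (hs : @IsTopologicalAddGroup X s _)
    (hs' : @ContinuousConstSMul ℂ X s _)
    (hts : ∀ S : Set X, @IsTotBounded X _ t S → @nhds X t 0 ⊓ 𝓟 S ≤ @nhds X s 0)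
    {D : Set X} (hcl : IsClosed[s] D) (hD : @IsCapacious X _ t D) (hc : Convex ℝ D)
    (hb : Balanced ℂ D) {S : Set X} (hS : @IsTotBounded X _ t S) {ε : ℝ} (hε : 0 < ε) :
    ∀ᶠ x in @nhds X t 0 ⊓ 𝓟 S, gauge D x < ε := by
  by_contra hne
  have hneBot := frequently_iff_neBot.1 (not_eventually.1 hne)
  -- Passing to an ultrafilter makes a single translate from the finite cover belong to it.
  set l := Ultrafilter.of ((@nhds X t 0 ⊓ 𝓟 S) ⊓ 𝓟 {x | ¬ gauge D x < ε})
  have hl : (l : Filter X) ≤ (@nhds X t 0 ⊓ 𝓟 S) ⊓ 𝓟 {x | ¬ gauge D x < ε} := Ultrafilter.of_le _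
  have hlS : S ∈ l := le_principal_iff.1 (hl.trans (inf_le_left.trans inf_le_right))
  have hlε : {x | ¬ gauge D x < ε} ∈ l := le_principal_iff.1 (hl.trans inf_le_right)
  have hls : (l : Filter X) ≤ @nhds X s 0 := (hl.trans inf_le_left).trans (hts S hS)
  have hδ : 0 < ε / 4 := by positivity
  obtain ⟨F, hF, hSF⟩ := hD _ (@IsTotBounded.smul X _ _ S t ht hS ((ε / 4)⁻¹ : ℝ))
  have hcov : S ⊆ ⋃ a ∈ F, {x | (((ε / 4)⁻¹ : ℝ) : ℂ) • x - a ∈ D} := by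
    intro x hx
    obtain ⟨d, hd, a, ha, hda⟩ := hSF (smul_mem_smul_set hx)
    refine mem_biUnion ha ?_
    rw [mem_ofPred_eq, ← show d + a = _ from hda, add_sub_cancel_right]
    exact hd
  obtain ⟨a, -, hal⟩ := (Ultrafilter.finite_biUnion_mem_iff hF).1 (mem_of_superset hlS hcov)
  obtain ⟨x, hxa, hxε⟩ := l.nonempty_of_mem (inter_mem hal hlε)
  refine hxε (lt_of_le_of_lt (gauge_le_of_inv_smul_mem (half_pos hε) ?_) (half_lt_self hε))
  -- Two points of one translate of `(ε / 4)D` differ by an element of `(ε / 2)D`. Letting `y` tend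
  -- to zero for `s` and using that `D` is `s`-closed puts `x` itself in `(ε / 2)D`.
  refine @smul_mem_of_eventually_smul_sub_mem X _ _ s hs hs' D hcl l _ hls _ _ ?_
  filter_upwards [hal] with y hy
  have hmid := hc hxa (hb.neg_mem_iff.2 hy) (by norm_num : (0 : ℝ) ≤ 1 / 2)
    (by norm_num : (0 : ℝ) ≤ 1 / 2) (by norm_num)
  convert hmid using 1
  simp only [Complex.coe_smul]
  rw [show (ε / 2)⁻¹ = 1 / 2 * (ε / 4)⁻¹ by field_simp; norm_num]
  module

/-- A family of seminorms that contains the continuous ones, consists of seminorms continuous at zero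
on totally bounded sets, and contains the gauges of the capacious sets that are closed for the
topology it generates, generates a pseudosaturated refinement. -/
theorem isPseudosaturatedRefinement_of_withSeminorms {t s : TopologicalSpace X}
    (ht : @PolynormableSpace ℂ X _ _ _ t) {Q : Seminorm ℂ X → Prop}
    (hs : WithSeminorms (topology := s) (fun p : {p : Seminorm ℂ X // Q p} => p.1))
    (hQc : ∀ p : Seminorm ℂ X, @Continuous X ℝ t _ p → Q p)
    (hQ : ∀ p : Seminorm ℂ X, Q p → ∀ S : Set X, @IsTotBounded X _ t S → ∀ ε > 0,
      ∀ᶠ x in @nhds X t 0 ⊓ 𝓟 S, p x < ε)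
    (hQg : ∀ D : Set X, IsClosed[s] D → @IsCapacious X _ t D → ∀ (hc : Convex ℝ D)
      (hb : Balanced ℂ D) (ha : Absorbent ℝ D),
      (∀ S : Set X, @IsTotBounded X _ t S → ∀ ε > 0,
        ∀ᶠ x in @nhds X t 0 ⊓ 𝓟 S, gauge D x < ε) → Q (gaugeSeminorm hb hc ha)) :
    IsPseudosaturatedRefinement t s ∧
      ∀ S : Set X, @IsTotBounded X _ t S → @nhds X t 0 ⊓ 𝓟 S ≤ @nhds X s 0 := by
  have hsg := isTopologicalAddGroup_of_withSeminorms hs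
  have hsm := continuousSMul_of_withSeminorms hs
  have htg := isTopologicalAddGroup_of_withSeminorms ht.withSeminorms'
  have htm := continuousSMul_of_withSeminorms ht.withSeminorms'
  have hts : ∀ S : Set X, @IsTotBounded X _ t S → @nhds X t 0 ⊓ 𝓟 S ≤ @nhds X s 0 :=
    fun S hS =>
      show Tendsto id (@nhds X t 0 ⊓ 𝓟 S) (@nhds X s 0) from
        (WithSeminorms.tendsto_nhds hs id 0).2 fun p ε hε => by
          simpa using hQ p.1 p.2 S hS ε hε
  refine ⟨⟨?_, @WithSeminorms.toPolynormableSpace _ _ _ _ _ _ s _ hs, ?_⟩, hts⟩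
  · exact continuous_id_iff_le.1 <| continuous_of_withSeminorms hsg ht.withSeminorms'
      LinearMap.id fun p => continuous_seminorm_of_withSeminorms hs ⟨p.1, hQc p.1 p.2⟩
  · refine isPseudosaturated_of_withSeminorms hs fun D hcl hD hc hb ha => ?_
    have hDt : @IsCapacious X _ t D := fun S hS => hD S (hS.of_nhds_inf_le htg hts)
    exact ⟨⟨_, hQg D hcl hDt hc hb ha fun S hS ε hε =>
      tendsto_gauge_of_isCapacious (@ContinuousSMul.continuousConstSMul ℂ X _ t _ htm) hsg
        (@ContinuousSMul.continuousConstSMul ℂ X _ s _ hsm) hts hcl hDt hc hb hS hε⟩, rfl⟩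

theorem exists_withSeminorms {ι : Type*} (q : SeminormFamily ℂ X ι) :
    ∃ s : TopologicalSpace X, WithSeminorms (topology := s) q :=
  ⟨q.moduleFilterBasis.topology, @WithSeminorms.mk _ _ _ _ _ _ q (_) rfl⟩

/-- The largest admissible family, all seminorms continuous at zero on totally bounded sets,
generates a pseudosaturated refinement, and the pseudosaturation is coarser still. -/
theorem nhds_inf_principal_le_pseudosatTopology {t : TopologicalSpace X}
    (ht : PolynormableSpace ℂ X) {S : Set X} (hS : IsTotBounded S) :
    @nhds X t 0 ⊓ 𝓟 S ≤ @nhds X (pseudosatTopology t) 0 := by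
  obtain ⟨s, hs⟩ := exists_withSeminorms fun p : {p : Seminorm ℂ X // ∀ S : Set X,
    @IsTotBounded X _ t S → ∀ ε > 0, ∀ᶠ x in @nhds X t 0 ⊓ 𝓟 S, p x < ε} => p.1
  obtain ⟨h1, h2⟩ := isPseudosaturatedRefinement_of_withSeminorms ht hs (fun p hp S _ ε hε => by
    have h : ∀ᶠ x in @nhds X t 0, p x < ε :=
      (@Continuous.tendsto _ _ t _ _ hp 0).eventually_lt_const (by simpa using hε)
    exact h.filter_mono inf_le_left) (fun p hp => hp) (fun D _ _ hc hb ha h => h)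
  exact (h2 S hS).trans (nhds_mono h1.le_pseudosatTopology)

end Agreement

/-! ### Properties inherited by the pseudosaturation -/

namespace Pseudosat

variable (X : Type*) [AddCommGroup X] [Module ℂ X] [TopologicalSpace X] [PolynormableSpace ℂ X]

theorem toBase_injective : Function.Injective (toBase X) := fun _ _ h => h

theorem toBase_surjective : Function.Surjective (toBase X) := fun x => ⟨x, rfl⟩

instance [T2Space X] : T2Space (Pseudosat X) :=
  .of_injective_continuous (toBase_injective X) (toBase X).continuous

variable {X}

theorem comap_toBase_inf_principal_le {S : Set (Pseudosat X)}
    (hS : IsTotBounded (toBase X '' S)) : comap (toBase X) (𝓝 0) ⊓ 𝓟 S ≤ 𝓝 0 := by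
  have h := nhds_inf_principal_le_pseudosatTopology (X := X) inferInstance hS
  rw [← image_id S]
  exact (inf_le_inf_right _ (comap_id (f := 𝓝 (0 : X))).le).trans h

theorem isPseudocomplete [IsTopologicalAddGroup X] (hX : IsPseudocomplete X) :
    IsPseudocomplete (Pseudosat X) := by
  intro S hS l hl hSl hC
  have himg : ∀ {T : Set (Pseudosat X)}, IsTotBounded T → IsTotBounded (toBase X '' T) :=
    fun hT => hT.image (toBase X).toLinearMap.toAddMonoidHom (toBase X).continuous
  obtain ⟨x, hx⟩ := hX _ (himg hS) (Filter.map (toBase X) l) inferInstance (image_mem_map hSl) (by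
    intro U hU
    obtain ⟨A, hA, h⟩ := hC _ ((toBase X).continuous.continuousAt.preimage_mem_nhds
      (by simpa using hU))
    refine ⟨_, image_mem_map hA, ?_⟩
    rintro _ ⟨a, ha, rfl⟩ _ ⟨b, hb, rfl⟩
    rw [← map_sub]
    exact h a ha b hb)
  obtain ⟨y, rfl⟩ := toBase_surjective X x
  refine ⟨y, ?_⟩
  -- The topologies are compared only at zero, so the limit is translated there; `S - {y}` remains
  -- totally bounded.
  have h1 : Tendsto (fun z => z - y) l (comap (toBase X) (𝓝 0) ⊓ 𝓟 (S - {y})) := by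
    refine tendsto_inf.2 ⟨tendsto_comap_iff.2 ?_, tendsto_principal.2 ?_⟩
    · have : Tendsto (fun z => toBase X z - toBase X y) l (𝓝 (toBase X y - toBase X y)) :=
        Tendsto.sub_const hx _
      rw [sub_self] at this
      exact this.congr fun z => (map_sub _ _ _).symm
    · filter_upwards [hSl] with z hz
      exact ⟨z, hz, y, rfl, rfl⟩
  have h2 := (h1.mono_right (comap_toBase_inf_principal_le
    (himg (hS.sub (isTotBounded_singleton y))))).add_const y
  simpa [Tendsto] using h2

end Pseudosat
-- Equicontinuity into the pseudosaturation
section Abstract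

variable {A Y ι : Type*} [AddCommGroup A] [Module ℂ A] [TopologicalSpace A]
  [IsTopologicalAddGroup A] [ContinuousSMul ℂ A] [AddCommGroup Y] [Module ℂ Y]
  [t : TopologicalSpace Y] [ht : PolynormableSpace ℂ Y]

/-- A family of linear maps on a pseudosaturated space that is equicontinuous into `Y` is
equicontinuous into `Y^△` if the sets that it uniformly carries into `D` are capacious for every
convex absorbent `D` whose gauge is continuous at zero on totally bounded sets. -/
theorem setOf_forall_mem_nhds_pseudosat (hA : IsPseudosaturated A) (E : ι → A →ₗ[ℂ] Y) {T : Set ι}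
    (hT : ∀ {V : Set Y}, V ∈ 𝓝 0 → {a : A | ∀ i ∈ T, E i a ∈ V} ∈ 𝓝 0)
    (hTc : ∀ {D : Set Y}, Convex ℝ D → Absorbent ℝ D →
      (∀ S : Set Y, IsTotBounded S → ∀ ε > 0, ∀ᶠ x in 𝓝 0 ⊓ 𝓟 S, gauge D x < ε) →
      ∀ {ε : ℝ}, 0 < ε → IsCapacious {a : A | ∀ i ∈ T, ((ε⁻¹ : ℝ) : ℂ) • E i a ∈ D})
    {V : Set (Pseudosat Y)} (hV : V ∈ 𝓝 (0 : Pseudosat Y)) :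
    {a : A | ∀ i ∈ T, ∀ y : Pseudosat Y, Pseudosat.toBase Y y = E i a → y ∈ V} ∈ 𝓝 0 := by
  have hdir : ∀ p : Seminorm ℂ Y, Continuous p → ∀ ε > 0, ∀ᶠ x in 𝓝 (0 : Y), p x < ε :=
    fun p hp ε hε => (hp.tendsto 0).eventually_lt_const (by simpa using hε)
  -- The second clause is the desired conclusion, stated for one seminorm. It remains to see that
  -- the topology generated by `Q` is fine enough to see every neighbourhood of zero of `Y^△`.
  let Q : Seminorm ℂ Y → Prop := fun p =>
    (∀ S : Set Y, IsTotBounded S → ∀ ε > 0, ∀ᶠ x in 𝓝 0 ⊓ 𝓟 S, p x < ε) ∧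
      ∀ ε > 0, {a : A | ∀ i ∈ T, p (E i a) ≤ ε} ∈ 𝓝 0
  obtain ⟨s, hs⟩ := exists_withSeminorms fun p : {p : Seminorm ℂ Y // Q p} => p.1
  have hev : ∀ i ∈ T, @Continuous A Y _ s (E i) := by
    intro i hi
    refine continuous_of_withSeminorms inferInstance hs _ fun p => ?_
    refine Seminorm.continuous' (r := 1) (mem_of_superset (p.2.2 1 one_pos) fun a ha => ?_)
    rw [Seminorm.mem_closedBall_zero]
    exact ha i hi
  obtain ⟨h, -⟩ := isPseudosaturatedRefinement_of_withSeminorms ht hs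
    (fun p hp => ⟨fun S _ ε hε => (hdir p hp ε hε).filter_mono inf_le_left, fun ε hε =>
      mem_of_superset (hT (hdir p hp ε hε)) fun a ha i hi => (ha i hi).le⟩) (fun p hp => hp.1) (by
    intro D hcl hD hc hb ha hgauge
    refine ⟨hgauge, fun ε hε => ?_⟩
    refine mem_of_superset (hA {φ : A |
      ∀ f ∈ T, ((ε⁻¹ : ℝ) : ℂ) • E f φ ∈ D} ?_ ?_ ?_
      (hTc hc ha hgauge hε))
      fun φ hφ f hf => gauge_le_of_inv_smul_mem hε (hφ f hf)
    · have heq : {φ : A |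
          ∀ f ∈ T, ((ε⁻¹ : ℝ) : ℂ) • E f φ ∈ D} =
          ⋂ f ∈ T, (fun φ => E f (((ε⁻¹ : ℝ) : ℂ) • φ)) ⁻¹' D := by
        ext φ
        simp
      rw [heq]
      exact isClosed_biInter fun f hf => IsClosed.preimage
        (@Continuous.comp _ _ _ _ _ s _ _ (hev f hf) (continuous_const_smul _)) hcl
    · intro φ hφ ψ hψ a b ha hb hab f hf
      have := hc (hφ f hf) (hψ f hf) ha hb hab
      convert this using 1
      simp only [← Complex.coe_smul, map_add, map_smul, smul_add]
      simp only [smul_smul, mul_comm]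
    · rintro c hc _ ⟨φ, hφ, rfl⟩ f hf
      have := hb.smul_mem hc (hφ f hf)
      rwa [smul_comm, ← map_smul] at this)
  obtain ⟨I, r, hr, hI⟩ := (hs.mem_nhds_iff 0 _).1 (nhds_mono h.le_pseudosatTopology hV)
  refine mem_of_superset ((Finset.iInter_mem_sets I).2 fun p _ => p.2.2 (r / 2) (half_pos hr))
    fun φ hφ f hf y hy =>
      hI (show @Pseudosat.toBase Y _ _ t ht y ∈ _ from (Seminorm.mem_ball_zero _).2 ?_)
  refine Seminorm.finset_sup_apply_lt hr fun p hp => ?_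
  have h1 : p.1 (@Pseudosat.toBase Y _ _ t ht y) ≤ r / 2 := hy ▸ mem_iInter₂.1 hφ p hp f hf
  exact h1.trans_lt (half_lt_self hr)

end Abstract

/-! ### Operators on polars: lifting the target to `Y^△` -/

namespace PrimaryTensor

variable {X : Type*} [AddCommGroup X] [Module ℂ X] [TopologicalSpace X]
  {Y : Type*} [AddCommGroup Y] [Module ℂ Y] [TopologicalSpace Y] [IsTopologicalAddGroup Y]

theorem setOf_mapsTo_polar_mem_nhds {U : Set X} (hU : U ∈ 𝓝 (0 : X)) {V : Set Y}
    (hV : V ∈ 𝓝 (0 : Y)) : {φ : PrimaryTensor X Y | ∀ f ∈ polar X U, φ f ∈ V} ∈ 𝓝 0 :=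
  UniformConvergenceCLM.eventually_nhds_zero_mapsTo (RingHom.id ℂ)
    (𝔖 := nhdsPolars X) ⟨U, hU, rfl⟩ hV

theorem exists_subset_of_mem_nhds {W : Set (PrimaryTensor X Y)} (hW : W ∈ 𝓝 0) :
    ∃ U ∈ 𝓝 (0 : X), ∃ V ∈ 𝓝 (0 : Y),
      {φ : PrimaryTensor X Y | ∀ f ∈ polar X U, φ f ∈ V} ⊆ W := by
  obtain ⟨⟨_, V⟩, ⟨⟨U, hU, rfl⟩, hV⟩, h⟩ := (UniformConvergenceCLM.hasBasis_nhds_zero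
    (RingHom.id ℂ) Y (nhdsPolars X) (nhdsPolars_nonempty X) (directedOn_nhdsPolars X)).mem_iff.1 hW
  exact ⟨U, hU, V, hV, h⟩

variable [IsTopologicalAddGroup X] [ContinuousSMul ℂ X]

/-- The values of a totally bounded set of operators on the polar of a neighbourhood of zero form a
totally bounded set. -/
theorem isTotBounded_image2 {Φ : Set (PrimaryTensor X Y)} (hΦ : IsTotBounded Φ) {U : Set X}
    (hU : U ∈ 𝓝 (0 : X)) : IsTotBounded (image2 (fun φ f => φ f) Φ (polar X U)) := by
  intro V hV
  obtain ⟨V', hV', hVV⟩ := exists_nhds_zero_half hV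
  obtain ⟨F, hF, hΦF⟩ := hΦ _ (setOf_mapsTo_polar_mem_nhds hU hV')
  have htb : ∀ φ : PrimaryTensor X Y, ∃ G : Set Y, G.Finite ∧ φ '' polar X U ⊆ G + V' := fun φ =>
    (isTotBounded_polar hU).image (φ : SDual X →ₗ[ℂ] Y).toAddMonoidHom (map_continuous φ) V' hV'
  choose G hG hGV using htb
  refine ⟨⋃ φ ∈ F, G φ, hF.biUnion fun φ _ => hG φ, ?_⟩
  rintro _ ⟨_, hψ, f, hf, rfl⟩
  obtain ⟨φ, hφ, θ, hθ, rfl⟩ := hΦF hψ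
  obtain ⟨a, ha, v, hv, hav⟩ := hGV φ ⟨f, hf, rfl⟩
  refine ⟨a, mem_biUnion hφ ha, v + θ f, hVV v hv _ (hθ f hf), ?_⟩
  change a + (v + θ f) = φ f + θ f
  rw [← add_assoc, show a + v = φ f from hav]

variable [ContinuousSMul ℂ Y]

/-- Evaluation at `f` as a linear map on the pseudosaturation. -/
noncomputable def evalAt [PolynormableSpace ℂ Y] (f : SDual X) :
    Pseudosat (PrimaryTensor X Y) →ₗ[ℂ] Y where
  toFun φ := Pseudosat.toBase (PrimaryTensor X Y) φ f
  map_add' _ _ := rfl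
  map_smul' _ _ := rfl

variable [PolynormableSpace ℂ Y]

/-- All values of a totally bounded family on the polar lie in one totally bounded set `W`. On `W -
W` the gauge of `D` is small near zero, so operators uniformly close on the polar differ there by
elements of `εD`. -/
theorem isCapacious_setOf_mapsTo {D : Set Y} (hc : Convex ℝ D) (ha : Absorbent ℝ D)
    (hD : ∀ S : Set Y, IsTotBounded S → ∀ ε > 0, ∀ᶠ x in 𝓝 0 ⊓ 𝓟 S, gauge D x < ε)
    {U : Set X} (hU : U ∈ 𝓝 (0 : X)) {ε : ℝ} (hε : 0 < ε) :
    IsCapacious {φ : Pseudosat (PrimaryTensor X Y) |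
      ∀ f ∈ polar X U, ((ε⁻¹ : ℝ) : ℂ) • evalAt f φ ∈ D} := by
  intro Φ hΦ
  have hΦ' := hΦ.image (Pseudosat.toBase (PrimaryTensor X Y)).toLinearMap.toAddMonoidHom
    (Pseudosat.toBase (PrimaryTensor X Y)).continuous
  have hW := isTotBounded_image2 hΦ' hU
  obtain ⟨F, hFΦ, hF, hcov⟩ := hΦ'.exists_finite_subset
    (setOf_mapsTo_polar_mem_nhds hU (mem_inf_principal.1 (hD _ (hW.sub hW) ε hε)))
  refine ⟨Pseudosat.toBase (PrimaryTensor X Y) ⁻¹' F,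
    hF.preimage (Pseudosat.toBase_injective _).injOn, fun φ hφ => ?_⟩
  obtain ⟨ψ, hψ, hφψ⟩ := hcov _ ⟨φ, hφ, rfl⟩
  obtain ⟨ψ, rfl⟩ := Pseudosat.toBase_surjective _ ψ
  refine ⟨φ - ψ, fun f hf => inv_smul_mem_of_gauge_lt hc ha hε ?_, ψ, hψ, sub_add_cancel _ _⟩
  exact hφψ f hf ⟨_, ⟨_, ⟨φ, hφ, rfl⟩, f, hf, rfl⟩, _, ⟨_, hFΦ hψ, f, hf, rfl⟩, rfl⟩

/-- On `(X · Y)^△`, uniform convergence on polars holds even for the topology of `Y^△`. -/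
theorem setOf_mapsTo_mem_nhds_pseudosat {U : Set X} (hU : U ∈ 𝓝 (0 : X)) {V : Set (Pseudosat Y)}
    (hV : V ∈ 𝓝 (0 : Pseudosat Y)) :
    {φ : Pseudosat (PrimaryTensor X Y) | ∀ f ∈ polar X U,
      ∀ y : Pseudosat Y, Pseudosat.toBase Y y = evalAt f φ → y ∈ V} ∈ 𝓝 0 :=
  setOf_forall_mem_nhds_pseudosat (Pseudosat.isPseudosaturated _) (evalAt (X := X) (Y := Y))
    (fun hV => (Pseudosat.toBase (PrimaryTensor X Y)).continuous.continuousAt.preimage_mem_nhds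
      (setOf_mapsTo_polar_mem_nhds hU hV))
    (fun {_} hc ha hD {_} hε => isCapacious_setOf_mapsTo hc ha hD hU hε) hV

end PrimaryTensor
-- Transposition and the inverse map
noncomputable section Transpose

variable {X : Type*} [AddCommGroup X] [Module ℂ X] [TopologicalSpace X] [IsTopologicalAddGroup X]
  [ContinuousSMul ℂ X] [PolynormableSpace ℂ X] [T2Space X]

/-- For a pseudocomplete space `X`, the canonical map `X → X^⋆⋆` is a linear isomorphism. -/
def IsPseudocomplete.evalEquiv (hX : IsPseudocomplete X) : X ≃ₗ[ℂ] SDual (SDual X) :=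
  LinearEquiv.ofBijective (evalMap X) ⟨evalMap_injective, evalMap_surjective hX⟩

theorem IsPseudocomplete.apply_evalEquiv_symm (hX : IsPseudocomplete X) (ξ : SDual (SDual X))
    (f : SDual X) : f (hX.evalEquiv.symm ξ) = ξ f :=
  DFunLike.congr_fun (hX.evalEquiv.apply_symm_apply ξ) f

theorem eq_of_forall_dual_eq {x y : X} (h : ∀ f : SDual X, f x = f y) : x = y :=
  evalMap_injective (UniformConvergenceCLM.ext _ _ h)

variable {Y : Type*} [AddCommGroup Y] [Module ℂ Y] [TopologicalSpace Y] [IsTopologicalAddGroup Y]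
  [ContinuousSMul ℂ Y]

namespace PrimaryTensor

/-- The transpose `Y^⋆ → X` of an operator `X^⋆ → Y`, as a linear map. -/
def transposeFun (hX : IsPseudocomplete X) (φ : PrimaryTensor X Y) : SDual Y →ₗ[ℂ] X :=
  hX.evalEquiv.symm.toLinearMap ∘ₗ
    { toFun := fun g => ContinuousLinearMap.toUniformConvergenceCLM _ _ _
        ((ContinuousLinearMap.toUniformConvergenceCLM _ _ _).symm g ∘L
          (ContinuousLinearMap.toUniformConvergenceCLM _ _ _).symm φ)
      map_add' := fun _ _ => rfl
      map_smul' := fun _ _ => rfl }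

theorem apply_transposeFun (hX : IsPseudocomplete X) (φ : PrimaryTensor X Y) (g : SDual Y)
    (f : SDual X) : f (transposeFun hX φ g) = g (φ f) :=
  hX.apply_evalEquiv_symm _ f

theorem continuous_transposeFun (hX : IsPseudocomplete X) (φ : PrimaryTensor X Y) :
    Continuous (transposeFun hX φ) := by
  refine continuous_of_continuousAt_zero (transposeFun hX φ) ?_
  rw [ContinuousAt, map_zero]
  intro W hW
  obtain ⟨U, hU, hUW⟩ := exists_prepolar_polar_subset hW
  refine mem_map.2 (mem_of_superset (setOf_forall_norm_le_mem_nhds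
    ((isTotBounded_polar hU).image (φ : SDual X →ₗ[ℂ] Y).toAddMonoidHom (map_continuous φ)) one_pos)
    fun g hg => hUW fun f hf => ?_)
  rw [apply_transposeFun]
  exact hg _ ⟨f, hf, rfl⟩

/-- The transposition `X · Y → Y · X` for a pseudocomplete space `X`, as a linear map. -/
def transposeLinear (hX : IsPseudocomplete X) : PrimaryTensor X Y →ₗ[ℂ] PrimaryTensor Y X where
  toFun φ := ContinuousLinearMap.toUniformConvergenceCLM _ _ _
    ⟨transposeFun hX φ, continuous_transposeFun hX φ⟩
  map_add' φ ψ := UniformConvergenceCLM.ext _ _ fun g => eq_of_forall_dual_eq fun f => by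
    change f (transposeFun hX (φ + ψ) g) = f (transposeFun hX φ g + transposeFun hX ψ g)
    rw [map_add, apply_transposeFun, apply_transposeFun, apply_transposeFun, ← map_add]
    rfl
  map_smul' c φ := UniformConvergenceCLM.ext _ _ fun g => eq_of_forall_dual_eq fun f => by
    change f (transposeFun hX (c • φ) g) = f (c • transposeFun hX φ g)
    rw [map_smul, apply_transposeFun, apply_transposeFun, ← map_smul]
    rfl

theorem apply_transposeLinear (hX : IsPseudocomplete X) (φ : PrimaryTensor X Y) (g : SDual Y)
    (f : SDual X) : f (transposeLinear hX φ g) = g (φ f) :=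
  apply_transposeFun hX φ g f

/-- Both topologies measure the form `g (φ f)` on products of polars; the bipolar lemma replaces
membership in `U` by a bound against a polar. -/
theorem continuous_transposeLinear (hX : IsPseudocomplete X) :
    Continuous (transposeLinear hX : PrimaryTensor X Y →ₗ[ℂ] PrimaryTensor Y X) := by
  refine continuous_of_tendsto_nhds_zero _ fun W hW => ?_
  obtain ⟨V, hV, U, hU, hW'⟩ := exists_subset_of_mem_nhds hW
  obtain ⟨U', hU', hUU⟩ := exists_prepolar_polar_subset hU
  refine mem_map.2 (mem_of_superset (setOf_mapsTo_polar_mem_nhds hU' hV)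
    fun φ hφ => hW' fun g hg => hUU fun f hf => ?_)
  rw [apply_transposeLinear]
  exact hg _ (hφ f hf)

/-- The transposition `X · Y → Y · X` for a pseudocomplete space `X`. -/
def transpose (hX : IsPseudocomplete X) : PrimaryTensor X Y →L[ℂ] PrimaryTensor Y X :=
  ⟨transposeLinear hX, continuous_transposeLinear hX⟩

theorem apply_transpose (hX : IsPseudocomplete X) (φ : PrimaryTensor X Y) (g : SDual Y)
    (f : SDual X) : f (transpose hX φ g) = g (φ f) :=
  apply_transposeFun hX φ g f

variable [PolynormableSpace ℂ Y]

/-- An operator `X^⋆ → Y` considered as an operator `X^⋆ → Y^△`. -/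
def liftRightLinear (hX : IsPseudocomplete X) :
    Pseudosat (PrimaryTensor X Y) →ₗ[ℂ] PrimaryTensor X (Pseudosat Y) where
  toFun φ := ContinuousLinearMap.toUniformConvergenceCLM _ _ _
    (Pseudosat.lift hX.isPseudosaturated_dual
      ((ContinuousLinearMap.toUniformConvergenceCLM _ _ _).symm
        (Pseudosat.toBase (PrimaryTensor X Y) φ)))
  map_add' _ _ := rfl
  map_smul' _ _ := rfl

theorem continuous_liftRightLinear (hX : IsPseudocomplete X) :
    Continuous (liftRightLinear hX :
      Pseudosat (PrimaryTensor X Y) →ₗ[ℂ] PrimaryTensor X (Pseudosat Y)) := by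
  refine continuous_of_tendsto_nhds_zero _ fun W hW => ?_
  obtain ⟨U, hU, V, hV, hW'⟩ := exists_subset_of_mem_nhds hW
  exact mem_map.2 (mem_of_superset (setOf_mapsTo_mem_nhds_pseudosat hU hV)
    fun φ hφ => hW' fun f hf => hφ f hf _ rfl)

/-- The map `(X · Y)^△ → X · Y^△` that is the identity on operators. -/
def liftRight (hX : IsPseudocomplete X) :
    Pseudosat (PrimaryTensor X Y) →L[ℂ] PrimaryTensor X (Pseudosat Y) :=
  ⟨liftRightLinear hX, continuous_liftRightLinear hX⟩

variable [T2Space Y]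

/-- The inverse of `(△_X · △_Y)^△`. -/
def mapToBaseInv (hX : IsPseudocomplete X) (hY : IsPseudocomplete Y) :
    Pseudosat (PrimaryTensor X Y) →L[ℂ]
      Pseudosat (PrimaryTensor (Pseudosat X) (Pseudosat Y)) :=
  -- From the last factor up: `(X · Y)^△ → (X · Y^△)^△ → (Y^△ · X)^△ → (Y^△ · X^△)^△ → (X^△ ·
  -- Y^△)^△`.
  Pseudosat.map (transpose (Pseudosat.isPseudocomplete hY)) ∘L
    Pseudosat.lift (Pseudosat.isPseudosaturated _) (liftRight (Pseudosat.isPseudocomplete hY)) ∘L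
    Pseudosat.map (transpose hX) ∘L
    Pseudosat.lift (Pseudosat.isPseudosaturated _) (liftRight hX)

/-- The inverse is characterized by pairings alone: `θ` is the transpose of `φ` with values in
`X^△`. Both inverse identities then follow by testing against functionals. -/
theorem exists_mapToBaseInv (hX : IsPseudocomplete X) (hY : IsPseudocomplete Y)
    (φ : Pseudosat (PrimaryTensor X Y)) : ∃ θ : SDual (Pseudosat Y) → Pseudosat X,
      (∀ (f : SDual X) (g : SDual (Pseudosat Y)),
        f (Pseudosat.toBase X (θ g)) = g (liftRight hX φ f)) ∧
      ∀ (f : SDual (Pseudosat X)) (g : SDual (Pseudosat Y)),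
        g (Pseudosat.toBase _ (mapToBaseInv hX hY φ) f) = f (θ g) :=
  ⟨fun g => liftRight (Pseudosat.isPseudocomplete hY)
      (Pseudosat.map (transpose hX) (Pseudosat.lift (Pseudosat.isPseudosaturated _)
        (liftRight hX) φ)) g,
    fun f g => apply_transpose hX (liftRight hX φ) g f,
    fun f g => apply_transpose (Pseudosat.isPseudocomplete hY) _ f g⟩

theorem mapToBaseInv_map (hX : IsPseudocomplete X) (hY : IsPseudocomplete Y)
    (ψ : Pseudosat (PrimaryTensor (Pseudosat X) (Pseudosat Y))) :
    mapToBaseInv hX hY (Pseudosat.map (map (Pseudosat.toBase X) (Pseudosat.toBase Y)) ψ) = ψ := by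
  obtain ⟨θ, h1, h2⟩ := exists_mapToBaseInv hX hY
    (Pseudosat.map (map (Pseudosat.toBase X) (Pseudosat.toBase Y)) ψ)
  refine Pseudosat.toBase_injective _ (UniformConvergenceCLM.ext _ _ fun f =>
    eq_of_forall_dual_eq fun g => ?_)
  rw [h2]
  have hψ := apply_transpose (Pseudosat.isPseudocomplete hX)
    (Pseudosat.toBase (PrimaryTensor (Pseudosat X) (Pseudosat Y)) ψ) g
  rw [← hψ f]
  congr 1
  refine Pseudosat.toBase_injective X (eq_of_forall_dual_eq fun f' => ?_)
  rw [h1]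
  exact (hψ (SDual.map (Pseudosat.toBase X) f')).symm

theorem map_mapToBaseInv (hX : IsPseudocomplete X) (hY : IsPseudocomplete Y)
    (φ : Pseudosat (PrimaryTensor X Y)) :
    Pseudosat.map (map (Pseudosat.toBase X) (Pseudosat.toBase Y)) (mapToBaseInv hX hY φ) = φ := by
  obtain ⟨θ, h1, h2⟩ := exists_mapToBaseInv hX hY φ
  refine Pseudosat.toBase_injective _ (UniformConvergenceCLM.ext _ _ fun f =>
    eq_of_forall_dual_eq fun g => ?_)
  exact (h2 (SDual.map (Pseudosat.toBase X) f) (SDual.map (Pseudosat.toBase Y) g)).trans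
    (h1 f (SDual.map (Pseudosat.toBase Y) g))

end PrimaryTensor

end Transpose

/-! ### Comparison of `Y : X^⋆` with `X · Y` -/

section Fraction

variable {X : Type*} [AddCommGroup X] [Module ℂ X] [TopologicalSpace X] [IsTopologicalAddGroup X]
  [ContinuousSMul ℂ X]
  {Y : Type*} [AddCommGroup Y] [Module ℂ Y] [TopologicalSpace Y] [IsTopologicalAddGroup Y]
  [ContinuousSMul ℂ Y]

variable (X Y) in
/-- The map `Y : X^⋆ → X · Y` that is the identity on operators. -/
def fractionToTensor : PrimaryFraction (SDual X) Y →L[ℂ] PrimaryTensor X Y where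
  toFun φ := φ
  map_add' _ _ := rfl
  map_smul' _ _ := rfl
  cont := continuous_id_iff_le.2 <| UniformConvergenceCLM.topologicalSpace_mono _ _ <| by
    rintro _ ⟨U, hU, rfl⟩
    exact isTotBounded_polar hU

variable (X Y) in
/-- The map `X · Y → Y : X^⋆` that is the identity on operators, as a linear map. -/
def tensorToFractionLinear : PrimaryTensor X Y →ₗ[ℂ] PrimaryFraction (SDual X) Y where
  toFun φ := φ
  map_add' _ _ := rfl
  map_smul' _ _ := rfl

/-- A totally bounded `T` lies in the polar of its prepolar, and pseudosaturation makes that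
prepolar a neighbourhood of zero. -/
theorem continuous_tensorToFractionLinear (hX : IsPseudosaturated X) :
    Continuous (tensorToFractionLinear X Y) := by
  refine continuous_of_tendsto_nhds_zero _ fun W hW => ?_
  obtain ⟨⟨T, V⟩, ⟨hT, hV⟩, h⟩ := (UniformConvergenceCLM.hasBasis_nhds_zero
    (RingHom.id ℂ) Y (totBoundedSets (SDual X)) (totBoundedSets_nonempty _)
    (directedOn_totBoundedSets _)).mem_iff.1 hW
  exact mem_map.2 (mem_of_superset (PrimaryTensor.setOf_mapsTo_polar_mem_nhds
    (hX.prepolar_mem_nhds hT) hV) fun φ hφ => h fun f hf => hφ f fun x hx => hx f hf)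

variable (X Y) in
/-- The map `X · Y → Y : X^⋆` that is the identity on operators. -/
def tensorToFraction (hX : IsPseudosaturated X) :
    PrimaryTensor X Y →L[ℂ] PrimaryFraction (SDual X) Y :=
  ⟨tensorToFractionLinear X Y, continuous_tensorToFractionLinear hX⟩

end Fraction
end Stereotype

/-! ### The theorem -/

theorem mainTheorem1 (X Y : Type*)
    [AddCommGroup X] [Module ℂ X] [TopologicalSpace X] [IsTopologicalAddGroup X]
    [ContinuousSMul ℂ X] [PolynormableSpace ℂ X] [T2Space X]
    [AddCommGroup Y] [Module ℂ Y] [TopologicalSpace Y] [IsTopologicalAddGroup Y]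
    [ContinuousSMul ℂ Y] [PolynormableSpace ℂ Y] [T2Space Y]
    (hX : IsPseudocomplete X) (hY : IsPseudocomplete Y) :
    -- `X^△` and `Y^△` are stereotype spaces, so that `X^△ ⊙ Y^△` is defined
    (IsStereotype (Pseudosat X) ∧ IsStereotype (Pseudosat Y)) ∧
    -- `X^△ ⊙ Y^△ ≅ (X^△ · Y^△)^△` by the map that is the identity on operators
    (∃ e : InjectiveTensor (Pseudosat X) (Pseudosat Y) ≃L[ℂ]
        Pseudosat (PrimaryTensor (Pseudosat X) (Pseudosat Y)),
      ∀ (u : InjectiveTensor (Pseudosat X) (Pseudosat Y)) (f : SDual (Pseudosat X)),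
        Pseudosat.toBase (PrimaryTensor (Pseudosat X) (Pseudosat Y)) (e u) f =
          Pseudosat.toBase (PrimaryFraction (SDual (Pseudosat X)) (Pseudosat Y)) u f) ∧
    -- `(△_X · △_Y)^△ : (X^△ · Y^△)^△ → (X · Y)^△` is an isomorphism
    (∃ e : Pseudosat (PrimaryTensor (Pseudosat X) (Pseudosat Y)) ≃L[ℂ]
        Pseudosat (PrimaryTensor X Y),
      (e : Pseudosat (PrimaryTensor (Pseudosat X) (Pseudosat Y)) →L[ℂ]
          Pseudosat (PrimaryTensor X Y)) =
        Pseudosat.map (PrimaryTensor.map (Pseudosat.toBase X) (Pseudosat.toBase Y))) := by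
  have hX' := Pseudosat.isPseudosaturated X
  refine ⟨⟨isStereotype (Pseudosat.isPseudocomplete hX) hX',
    isStereotype (Pseudosat.isPseudocomplete hY) (Pseudosat.isPseudosaturated Y)⟩, ?_, ?_⟩
  · exact ⟨.equivOfInverse (Pseudosat.map (fractionToTensor _ _))
      (Pseudosat.map (tensorToFraction _ _ hX')) (fun _ => rfl) fun _ => rfl, fun _ _ => rfl⟩
  · exact ⟨.equivOfInverse (Pseudosat.map (PrimaryTensor.map (Pseudosat.toBase X)
      (Pseudosat.toBase Y))) (PrimaryTensor.mapToBaseInv hX hY)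
      (PrimaryTensor.mapToBaseInv_map hX hY) (PrimaryTensor.map_mapToBaseInv hX hY), rfl⟩
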